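/- Let $d\ge 1$, $N\ge 0$ be integers. A polynomial curve $\gamma=(\gamma_1,\dots,\gamma_d):\mathbb R\to\mathbb R^d$ of degree at most $N$ is a curve whose components are real polynomials of degree at most $N$. Put $$L_\gamma(t)=\det(\gamma'(t),\dots,\gamma^{(d)}(t)),\qquad J_\gamma(t_1,\dots,t_d)=\det(\gamma'(t_1),\dots,\gamma'(t_d)),\qquad \lambda_\gamma=|L_\gamma|^{\frac{2}{d(d+1)}},$$ $$\mathcal E_\gamma g(x)=\int_{\mathbb R}e^{ix\cdot\gamma(t)}g(t)\,\lambda_\gamma(t)\,dt ,\qquad x\in\mathbb R^d .$$ For $g\in L^p(\lambda_\gamma\,dt)$ with $g\lambda_\gamma$ not integrable, $\mathcal E_\gamma g$ is understood as the distribution $\varphi\mapsto\int g(t)\lambda_\gamma(t)\bigl(\int e^{ix\cdot\gamma(t)}\varphi(x)\,dx\bigr)dt$, $\varphi\in C_c^\infty(\mathbb R^d)$, and $\|\mathcal E_\gamma g\|_{L^q}$ is $\infty$ unless this distribution is an $L^q$ function. Given $K$, consider intervals $I\subset\mathbb R$ with a center $b\in\mathbb R$, as produced by the Dendrinos–Wright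 decomposition of $\mathbb R$ for the curve $\gamma$ (with implicit constants $K$), that is, such that: 1. $b$ is not in the interior of $I$, and there are $A,B>0$ and integers $0\le k\le dN$, $0\le \ell\le N$ with $$K^{-1}A|t-b|^{k}\le|L_\gamma(t)|\le KA|t-b|^{k},\qquad K^{-1}B|t-b|^{\ell}\le|\gamma_1'(t)|\le KB|t-b|^{\ell}\qquad(t\in I);$$ 2. $|J_\gamma(t_1,\dots,t_d)|\ge K^{-1}\prod_{j}|L_\gamma(t_j)|^{1/d}\prod_{i<j}|t_j-t_i|$ for all $(t_1,\dots,t_d)\in I^d$; 3. $(t_1,\dots,t_d)\mapsto\sum_j\gamma(t_j)$ is one-to-one on $\{t\in I^d:t_1<\dots<t_d\}$. For $n\in\mathbb Z$ let $I_n=\{t\in I: 2^n\le|t-b|<2^{n+1}\}$. **Proposition.** Let $\frac{d^2+d+2}{2}<q<\infty$ and let $K$ be given. There is a constant $C<\infty$, depending only on $d$, $N$, $q$ and $K$, such that the following holds. If $\frac1p+\frac1{p'}=1$ with $q=\frac{d(d+1)}2p'$, $\gamma$ is a polynomial curve of degree at most $N$ with $L_\gamma\not\equiv0$, $(I,b)$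 is an interval with center as above, and $f\in L^p(\lambda_\gamma\,dt)$, then $$\|\mathcal E_\gamma(\chi_{I}f)\|_{L^q(\mathbb R^d)}\le C\,\Bigl\|\Bigl(\sum_{n\in\mathbb Z}\bigl|\mathcal E_\gamma(\chi_{I_n}f)\bigr|^2\Bigr)^{1/2}\Bigr\|_{L^q(\mathbb R^d)} .$$ (In the Dendrinos–Wright decomposition the constant $K$ depends only on $N$ and $d$; then $C$ depends only on $N$, $d$ and $q$.) -/

import Mathlib

open MeasureTheory Polynomial
open scoped ENNReal NNReal ContDiff

noncomputable section

namespace PolyCurve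

/-- The polynomial curve `t ↦ (γ 0 (t), …, γ (d-1) (t))` in Euclidean space. -/
def curve {d : ℕ} (γ : Fin d → ℝ[X]) (t : ℝ) : EuclideanSpace ℝ (Fin d) :=
  WithLp.toLp 2 (fun i => (γ i).eval t)

/-- The torsion `L_γ(t) = det(γ'(t), …, γ^{(d)}(t))`. -/
def torsion {d : ℕ} (γ : Fin d → ℝ[X]) (t : ℝ) : ℝ :=
  Matrix.det (Matrix.of fun i j : Fin d => (derivative^[(j : ℕ) + 1] (γ i)).eval t)

/-- `J_γ(t₁, …, t_d) = det(γ'(t₁), …, γ'(t_d))`. -/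
def jacobian {d : ℕ} (γ : Fin d → ℝ[X]) (t : Fin d → ℝ) : ℝ :=
  Matrix.det (Matrix.of fun i j : Fin d => (derivative (γ i)).eval (t j))

/-- The affine arclength density `λ_γ = |L_γ|^{2/(d(d+1))}`. -/
def weight {d : ℕ} (γ : Fin d → ℝ[X]) (t : ℝ) : ℝ :=
  |torsion γ t| ^ ((2 : ℝ) / ((d : ℝ) * ((d : ℝ) + 1)))

/-- Affine arclength measure `λ_γ dt`. -/
def affineArclength {d : ℕ} (γ : Fin d → ℝ[X]) : Measure ℝ :=
  volume.withDensity fun t => ENNReal.ofReal (weight γ t)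

/-- The oscillatory factor `e^{i x·γ(t)}`. -/
def wave {d : ℕ} (γ : Fin d → ℝ[X]) (x : EuclideanSpace ℝ (Fin d)) (t : ℝ) : ℂ :=
  Complex.exp (Complex.I * ((inner ℝ x (curve γ t) : ℝ) : ℂ))

/-- The extension operator `E_γ g(x) = ∫ e^{i x·γ(t)} g(t) λ_γ(t) dt`, as an absolutely convergent
integral. It is applied below only to functions `g` for which `g λ_γ` is integrable. -/
def extOp {d : ℕ} (γ : Fin d → ℝ[X]) (g : ℝ → ℂ) (x : EuclideanSpace ℝ (Fin d)) : ℂ :=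
  ∫ t, wave γ x t * g t * (weight γ t : ℂ)

/-- The function `F` is `E_γ g` in the sense of distributions: for all test functions `φ`,
`∫ F φ dx = ∫ g(t) λ_γ(t) (∫ e^{i x·γ(t)} φ(x) dx) dt`. For `g ∈ L^p(λ_γ dt)` with `1 ≤ p ≤ ∞` and
`L_γ ≢ 0` the right side converges absolutely, whether or not `g λ_γ` is integrable (the inner
integral is a Schwartz function evaluated at `γ(t)`). When `g λ_γ` is integrable, `F` is
`extOp γ g` up to a null set, by Fubini. -/
def IsExtension {d : ℕ} (γ : Fin d → ℝ[X]) (g : ℝ → ℂ)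
    (F : EuclideanSpace ℝ (Fin d) → ℂ) : Prop :=
  LocallyIntegrable F volume ∧
    ∀ φ : EuclideanSpace ℝ (Fin d) → ℂ, ContDiff ℝ ∞ φ → HasCompactSupport φ →
      ∫ x, F x * φ x = ∫ t, g t * (weight γ t : ℂ) * ∫ x, wave γ x t * φ x

/-- The `L^q(ℝ^d)` norm of the distribution `E_γ g`; it is `∞` unless `E_γ g` is an `L^q` function.
All functions `F` that represent `E_γ g` agree almost everywhere, so that the infimum is over
equal values. -/
def extNorm {d : ℕ} (γ : Fin d → ℝ[X]) (q : ℝ≥0∞) (g : ℝ → ℂ) : ℝ≥0∞ :=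
  ⨅ (F : EuclideanSpace ℝ (Fin d) → ℂ) (_ : IsExtension γ g F), eLpNorm F q volume

/-- `I` is an interval of the kind produced by the Dendrinos–Wright decomposition of a polynomial
curve of degree at most `N`, with center `b` and with all implicit constants equal to `K`. -/
structure IsDWInterval {d : ℕ} [NeZero d] (N : ℕ) (K : ℝ) (γ : Fin d → ℝ[X]) (I : Set ℝ)
    (b : ℝ) : Prop where
  /-- `I` is an interval, bounded or not, open, closed or half-open. -/
  ordConnected : I.OrdConnected
  /-- The center is not in the interior of `I`. -/
  center : b ∉ interior I
  /-- `|L_γ(t)| ∼ A |t - b|^k` on `I`. -/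
  torsion_sim : ∃ A : ℝ, 0 < A ∧ ∃ k : ℕ, k ≤ d * N ∧ ∀ t ∈ I,
    K⁻¹ * (A * |t - b| ^ k) ≤ |torsion γ t| ∧ |torsion γ t| ≤ K * (A * |t - b| ^ k)
  /-- `|γ₁'(t)| ∼ B |t - b|^ℓ` on `I`, where `γ₁` is the first coordinate of the curve. -/
  deriv_sim : ∃ B : ℝ, 0 < B ∧ ∃ l : ℕ, l ≤ N ∧ ∀ t ∈ I,
    K⁻¹ * (B * |t - b| ^ l) ≤ |(derivative (γ 0)).eval t| ∧
      |(derivative (γ 0)).eval t| ≤ K * (B * |t - b| ^ l)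
  /-- The geometric inequality
  `|J_γ(t₁, …, t_d)| ≳ ∏_j |L_γ(t_j)|^{1/d} ∏_{i<j} |t_j - t_i|` on `I^d`. -/
  geometric : ∀ t : Fin d → ℝ, (∀ j, t j ∈ I) →
    K⁻¹ * ((∏ j, |torsion γ (t j)| ^ ((1 : ℝ) / (d : ℝ))) *
      ∏ i : Fin d, ∏ j ∈ Finset.Ioi i, |t j - t i|) ≤ |jacobian γ t|
  /-- `(t₁, …, t_d) ↦ γ(t₁) + ⋯ + γ(t_d)` is one-to-one on `{t ∈ I^d : t₁ < ⋯ < t_d}`. -/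
  injOn : Set.InjOn (fun t : Fin d → ℝ => ∑ j, curve γ (t j))
    {t | (∀ j, t j ∈ I) ∧ StrictMono t}

/-- The dyadic piece `I_n = {t ∈ I : 2^n ≤ |t - b| < 2^{n+1}}`. -/
def dyadicPiece (I : Set ℝ) (b : ℝ) (n : ℤ) : Set ℝ :=
  {t | t ∈ I ∧ (2 : ℝ) ^ n ≤ |t - b| ∧ |t - b| < (2 : ℝ) ^ (n + 1)}

/-- The square function `(∑_n |E_γ(χ_{I_n} f)(x)|²)^{1/2}`, with values in `[0, ∞]`. -/
def squareFunction {d : ℕ} (γ : Fin d → ℝ[X]) (I : Set ℝ) (b : ℝ) (f : ℝ → ℂ)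
    (x : EuclideanSpace ℝ (Fin d)) : ℝ≥0∞ :=
  (∑' n : ℤ, ‖extOp γ ((dyadicPiece I b n).indicator f) x‖ₑ ^ 2) ^ ((1 : ℝ) / 2)

end PolyCurve

end

/-!
The inequality is a reverse Littlewood-Paley inequality in the first coordinate of `x`. Since
`|γ₁'(t)| ≈ B |t - b|^ℓ` on `I` and `b` is not interior to `I`, the derivative `γ₁'` has one sign on
`I`, and integration gives a constant `c` with `|γ₁(t) - c| ≈ |t - b|^(ℓ+1)`, even when `I` stays
away from `b` (`IsDWInterval.exists_annuli`). So, after a modulation by `c`, which changes no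
absolute value, the frequencies of `F_n = E_γ(χ_{I_n} f)` in the first coordinate lie in annuli
`|ξ₁| ≈ ρ_n` with `ρ_{n+1} ≥ 2 ρ_n`, and the constants depend on `K` and `N` only. No other property
of the curve is needed for the inequality itself.

For `q > 2` and sufficiently sparse `ρ_n`, the inequality for a finite sum
(`lintegral_sum_oscInt_rpow_le`) is obtained by a direct argument that avoids singular integrals and
randomization. Telescope `∫ |S|^q` over the partial sums `S_n = F_0 + ⋯ + F_{n-1}`, with the second
order Taylor inequality for `z ↦ |z|^q`. The first order term `∫ ⟨|S_n|^{q-2} S_n, F_n⟩` is treated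
by integration by parts in the first coordinate: write `F_n = ρ_n⁻¹ ∂₁ G_n` and move the derivative
to `S_n`. As `∂₁ S_n` is a sum of the functions `ρ_j H_j` with `j < n` and `H_j = ρ_j⁻¹ ∂₁ F_j`,
lacunarity bounds the sequence `ρ_n⁻¹ ∂₁ S_n` in `ℓ²` by `(H_j)` (`sum_sq_le_of_halving`). This
leaves `∫ W^{q-2} ∑ (|F_n|² + |G_n|² + |H_n|²)`, where `W` dominates all `|S_n|`
(`lintegral_sum_rpow_le_of_lacunary`). The functions `G_n`, `H_n` and `S_n` arise from `F_n` and from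
the full sum by smooth multipliers in the first coordinate at scale `ρ_n`, so they are dominated by
averages along the first axis against `(1 + s²)⁻¹`. The averages are self-adjoint, and their
maximal function is bounded on `L^p`, `p > 1` (`lintegral_lineMax_rpow_le`, from the Vitali covering
lemma on lines). Hölder's inequality gives `‖S‖_q^q ≤ C ‖(∑ |F_n|²)^{1/2}‖_q² ‖S‖_q^{q-2}`, and one
divides by the finite quantity `‖S‖_q^{q-2}`.

General finite sets of indices are split modulo a fixed `R` (`exists_eLpNorm_sum_extOp_le`). If the
square function is in `L^q`, the same bound on tails makes `∑ F_n` converge unconditionally in `L^q`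
(`exists_hasSum_of_squareFunction`), and the limit represents the distribution `E_γ(χ_I f)`, by
pairing with a test function piece by piece (`isExtension_of_hasSum`). The pairing of `f λ_γ` with
`t ↦ ∫ e^{i x·γ(t)} φ(x) dx` converges absolutely because this function decays faster than any power
of `|γ(t)|` and `γ₁` is not constant (`integrable_mul_curveTransform`). If `K < 1`, the hypotheses
force `I` to be finite, and there is nothing to prove.
-/

namespace PolyCurve

/-! ### The maximal function of averages along lines -/

/-- The weak type `(1,1)` inequality for the uncentered family of all intervals around a point,
for outer measure, so that no measurability is needed. -/
theorem mul_volume_setOf_lt_lintegral_closedBall_le (g : ℝ → ℝ≥0∞) {a : ℝ≥0∞} (ha : a ≠ 0)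
    (ha' : a ≠ ⊤) :
    a * volume {x : ℝ | ∃ R : ℝ, 0 < R ∧
      a * ENNReal.ofReal (2 * R) < ∫⁻ y in Metric.closedBall x R, g y} ≤ 5 * ∫⁻ y, g y := by
  by_cases hg : ∫⁻ y, g y = ⊤
  · rw [hg, ENNReal.mul_top (by norm_num)]
    exact le_top
  set A := {x : ℝ | ∃ R : ℝ, 0 < R ∧
      a * ENNReal.ofReal (2 * R) < ∫⁻ y in Metric.closedBall x R, g y} with hA
  choose! R hR0 hR using fun x (hx : x ∈ A) => hx
  have hbound : ∀ x ∈ A, R x ≤ (a⁻¹ * ∫⁻ y, g y).toReal := by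
    intro x hx
    have h1 : a * ENNReal.ofReal (2 * R x) ≤ ∫⁻ y, g y :=
      (hR x hx).le.trans (setLIntegral_le_lintegral _ _)
    have h2 : ENNReal.ofReal (2 * R x) ≤ a⁻¹ * ∫⁻ y, g y := by
      rw [← ENNReal.div_eq_inv_mul, ENNReal.le_div_iff_mul_le (Or.inl ha) (Or.inl ha'), mul_comm]
      exact h1
    have h3 := (ENNReal.ofReal_le_iff_le_toReal
      (ENNReal.mul_ne_top (ENNReal.inv_ne_top.2 ha) hg)).1 h2
    linarith [hR0 x hx]
  obtain ⟨u, huA, hdisj, hcov⟩ :=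
    Vitali.exists_disjoint_subfamily_covering_enlargement_closedBall A (fun x => x) R _ hbound 5
      (by norm_num)
  have hucount : u.Countable := by
    refine hdisj.countable_of_nonempty_interior fun x hx => ?_
    exact ⟨x, Metric.ball_subset_interior_closedBall (Metric.mem_ball_self (hR0 x (huA hx)))⟩
  have hsub : A ⊆ ⋃ x ∈ u, Metric.closedBall x (5 * R x) := by
    intro x hx
    obtain ⟨b, hb, hxb⟩ := hcov x hx
    exact Set.mem_biUnion hb (hxb (Metric.mem_closedBall_self (hR0 x hx).le))
  calc a * volume A ≤ a * ∑' x : u, volume (Metric.closedBall (x : ℝ) (5 * R x)) := by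
        gcongr
        exact (measure_mono hsub).trans (measure_biUnion_le _ hucount _)
    _ = ∑' x : u, 5 * (a * ENNReal.ofReal (2 * R x)) := by
        rw [← ENNReal.tsum_mul_left]
        congr with x
        rw [Real.volume_closedBall, show 2 * (5 * R (x : ℝ)) = 5 * (2 * R x) by ring,
          ENNReal.ofReal_mul (by norm_num)]
        simp only [ENNReal.ofReal_ofNat]
        ring
    _ ≤ ∑' x : u, 5 * ∫⁻ y in Metric.closedBall (x : ℝ) (R x), g y := by
        gcongr with x
        exact (hR x (huA x.2)).le
    _ = 5 * ∑' x : u, ∫⁻ y in Metric.closedBall (x : ℝ) (R x), g y := ENNReal.tsum_mul_left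
    _ = 5 * ∫⁻ y in ⋃ x ∈ u, Metric.closedBall x (R x), g y := by
        rw [lintegral_biUnion hucount (fun x _ => Metric.isClosed_closedBall.measurableSet) hdisj]
    _ ≤ 5 * ∫⁻ y, g y := by
        gcongr
        exact Measure.restrict_le_self

/-- A refined weak type inequality implies the strong type inequality, here for the truncation
of the majorized function at a finite height. -/
theorem lintegral_min_rpow_le {α : Type*} [MeasurableSpace α] {μ : Measure α} [SFinite μ]
    {p : ℝ} (hp : 1 < p)
    {A c : ℝ} (hA : 0 ≤ A) (hc : 0 < c) {T g : α → ℝ≥0∞} (hT : Measurable T) (hg : Measurable g)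
    (h : ∀ a : ℝ, 0 < a → ENNReal.ofReal a * μ {x | ENNReal.ofReal a < T x} ≤
      ENNReal.ofReal A * ∫⁻ x in {x | ENNReal.ofReal (c * a) < g x}, g x ∂μ) (n : ℕ) :
    ∫⁻ x, min (T x) n ^ p ∂μ ≤
      ENNReal.ofReal (p * A * (c⁻¹ ^ (p - 1) / (p - 1))) * ∫⁻ x, g x ^ p ∂μ := by
  have hp0 : 0 < p := by linarith
  set f : α → ℝ := fun x => (min (T x) n).toReal with hf
  have hfin : ∀ x, min (T x) (n : ℝ≥0∞) ≠ ⊤ := fun x =>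
    ne_top_of_le_ne_top (ENNReal.natCast_ne_top n) (min_le_right _ _)
  have hlayer := lintegral_rpow_eq_lintegral_meas_lt_mul μ (f := f)
    (Filter.Eventually.of_forall fun x => ENNReal.toReal_nonneg)
    ((hT.min measurable_const).ennreal_toReal.aemeasurable) hp0
  have hleft : ∫⁻ x, min (T x) n ^ p ∂μ = ∫⁻ x, ENNReal.ofReal (f x ^ p) ∂μ := by
    refine lintegral_congr fun x => ?_
    rw [← ENNReal.ofReal_rpow_of_nonneg ENNReal.toReal_nonneg hp0.le, ENNReal.ofReal_toReal (hfin x)]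
  rw [hleft, hlayer]
  have hinner : ∀ y : ℝ≥0∞, ∫⁻ t in Set.Ioi (0 : ℝ),
      Set.indicator {t : ℝ | ENNReal.ofReal (c * t) < y} (fun t => ENNReal.ofReal (t ^ (p - 2))) t
      ≤ ENNReal.ofReal (c⁻¹ ^ (p - 1) / (p - 1)) * y ^ (p - 1) := by
    intro y
    have hpos : 0 < c⁻¹ ^ (p - 1) / (p - 1) :=
      div_pos (Real.rpow_pos_of_pos (inv_pos.2 hc) _) (by linarith)
    by_cases hy : y = ⊤
    · rw [hy, ENNReal.top_rpow_of_pos (by linarith), ENNReal.mul_top]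
      · exact le_top
      · exact (ENNReal.ofReal_pos.2 hpos).ne'
    · calc _ ≤ ∫⁻ t in Set.Ioi (0 : ℝ), Set.indicator (Set.Ioc 0 (c⁻¹ * y.toReal))
              (fun t => ENNReal.ofReal (t ^ (p - 2))) t := by
            refine setLIntegral_mono' measurableSet_Ioi fun t ht => ?_
            by_cases h1 : ENNReal.ofReal (c * t) < y
            · rw [Set.indicator_of_mem (show t ∈ {t : ℝ | ENNReal.ofReal (c * t) < y} from h1),
                Set.indicator_of_mem]
              refine ⟨ht, ?_⟩
              rw [← div_eq_inv_mul, le_div_iff₀ hc, mul_comm]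
              exact (ENNReal.ofReal_le_iff_le_toReal hy).1 h1.le
            · rw [Set.indicator_of_notMem (by exact h1)]
              exact zero_le
        _ ≤ ∫⁻ t in Set.Ioc 0 (c⁻¹ * y.toReal), ENNReal.ofReal (t ^ (p - 2)) := by
            rw [← lintegral_indicator measurableSet_Ioc]
            exact setLIntegral_le_lintegral _ _
        _ = ENNReal.ofReal (∫ t in Set.Ioc 0 (c⁻¹ * y.toReal), t ^ (p - 2)) := by
            have hnn : 0 ≤ c⁻¹ * y.toReal := mul_nonneg (inv_nonneg.2 hc.le) ENNReal.toReal_nonneg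
            rw [ofReal_integral_eq_lintegral_ofReal]
            · have := (intervalIntegral.intervalIntegrable_rpow' (a := 0) (b := c⁻¹ * y.toReal)
                (r := p - 2) (by linarith)).1
              exact this
            · exact (ae_restrict_mem measurableSet_Ioc).mono fun t ht =>
                Real.rpow_nonneg ht.1.le _
        _ = ENNReal.ofReal (c⁻¹ ^ (p - 1) / (p - 1) * y.toReal ^ (p - 1)) := by
            have hnn : 0 ≤ c⁻¹ * y.toReal := mul_nonneg (inv_nonneg.2 hc.le) ENNReal.toReal_nonneg
            rw [← intervalIntegral.integral_of_le hnn, integral_rpow (Or.inl (by linarith)),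
              show p - 2 + 1 = p - 1 by ring, Real.zero_rpow (by linarith), sub_zero,
              Real.mul_rpow (inv_nonneg.2 hc.le) ENNReal.toReal_nonneg]
            ring_nf
        _ = _ := by
            rw [ENNReal.ofReal_mul hpos.le,
              ← ENNReal.ofReal_rpow_of_nonneg ENNReal.toReal_nonneg (by linarith),
              ENNReal.ofReal_toReal hy]
  have hmeas : Measurable (Function.uncurry fun (t : ℝ) (x : α) =>
      g x * Set.indicator {t : ℝ | ENNReal.ofReal (c * t) < g x}
        (fun t => ENNReal.ofReal (t ^ (p - 2))) t) := by
    refine (hg.comp measurable_snd).mul ?_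
    have : (fun a : ℝ × α => Set.indicator {t : ℝ | ENNReal.ofReal (c * t) < g a.2}
        (fun t => ENNReal.ofReal (t ^ (p - 2))) a.1) =
        Set.indicator {a : ℝ × α | ENNReal.ofReal (c * a.1) < g a.2}
          (fun a => ENNReal.ofReal (a.1 ^ (p - 2))) := by
      ext a
      simp [Set.indicator]
    rw [this]
    refine Measurable.indicator (by fun_prop) (measurableSet_lt (by fun_prop) (by fun_prop))
  calc ENNReal.ofReal p * ∫⁻ t in Set.Ioi 0, μ {a | t < f a} * ENNReal.ofReal (t ^ (p - 1))
      ≤ ENNReal.ofReal p * ∫⁻ t in Set.Ioi (0 : ℝ), ENNReal.ofReal A *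
          ∫⁻ x, g x * Set.indicator {t : ℝ | ENNReal.ofReal (c * t) < g x}
            (fun t => ENNReal.ofReal (t ^ (p - 2))) t ∂μ := by
        gcongr ENNReal.ofReal p * ?_
        refine setLIntegral_mono' measurableSet_Ioi fun t ht => ?_
        have ht : 0 < t := ht
        have h1 : μ {a | t < f a} ≤ μ {x | ENNReal.ofReal t < T x} := by
          refine measure_mono fun x hx => ?_
          exact ((ENNReal.ofReal_lt_iff_lt_toReal ht.le (hfin x)).2 hx).trans_le (min_le_left _ _)
        have h2 : ENNReal.ofReal (t ^ (p - 1)) = ENNReal.ofReal t * ENNReal.ofReal (t ^ (p - 2)) := by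
          rw [← ENNReal.ofReal_mul ht.le]
          congr 1
          rw [show p - 1 = 1 + (p - 2) by ring, Real.rpow_add ht, Real.rpow_one]
        calc μ {a | t < f a} * ENNReal.ofReal (t ^ (p - 1))
            ≤ μ {x | ENNReal.ofReal t < T x} * ENNReal.ofReal (t ^ (p - 1)) := by gcongr
          _ = (ENNReal.ofReal t * μ {x | ENNReal.ofReal t < T x}) * ENNReal.ofReal (t ^ (p - 2)) := by
              rw [h2]; ring
          _ ≤ (ENNReal.ofReal A * ∫⁻ x in {x | ENNReal.ofReal (c * t) < g x}, g x ∂μ) *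
                ENNReal.ofReal (t ^ (p - 2)) := mul_le_mul_left (h t ht) _
          _ = _ := by
              rw [mul_assoc, ← lintegral_mul_const _ hg,
                ← lintegral_indicator (measurableSet_lt measurable_const hg)]
              congr 1
              refine lintegral_congr fun x => ?_
              simp [Set.indicator]
    _ = ENNReal.ofReal p * (ENNReal.ofReal A * ∫⁻ x, (∫⁻ t in Set.Ioi (0 : ℝ),
          g x * Set.indicator {t : ℝ | ENNReal.ofReal (c * t) < g x}
            (fun t => ENNReal.ofReal (t ^ (p - 2))) t) ∂μ) := by
        rw [lintegral_const_mul' _ _ ENNReal.ofReal_ne_top,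
          lintegral_lintegral_swap hmeas.aemeasurable]
    _ ≤ ENNReal.ofReal p * (ENNReal.ofReal A * ∫⁻ x,
          ENNReal.ofReal (c⁻¹ ^ (p - 1) / (p - 1)) * g x ^ p ∂μ) := by
        refine mul_le_mul_right (mul_le_mul_right (lintegral_mono fun x => ?_) _) _
        rw [lintegral_const_mul]
        · calc _ ≤ g x * (ENNReal.ofReal (c⁻¹ ^ (p - 1) / (p - 1)) * g x ^ (p - 1)) := by
                gcongr; exact hinner _
            _ = _ := by
                rw [mul_left_comm]
                congr 1
                nth_rewrite 1 [← ENNReal.rpow_one (g x)]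
                rw [← ENNReal.rpow_add_of_nonneg _ _ zero_le_one (by linarith)]
                congr 1; ring
        · exact Measurable.indicator (by fun_prop) (measurableSet_lt (by fun_prop) (by fun_prop))
    _ = _ := by
        rw [lintegral_const_mul _ (hg.pow_const p), ENNReal.ofReal_mul (by positivity),
          ENNReal.ofReal_mul hp0.le]
        ring

/-- Marcinkiewicz interpolation between a refined weak type `(1,1)` bound and the trivial
bound. -/
theorem lintegral_rpow_le_of_weak_type {α : Type*} [MeasurableSpace α] {μ : Measure α} [SFinite μ]
    {p : ℝ} (hp : 1 < p)
    {A c : ℝ} (hA : 0 ≤ A) (hc : 0 < c) {T g : α → ℝ≥0∞} (hT : Measurable T) (hg : Measurable g)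
    (h : ∀ a : ℝ, 0 < a → ENNReal.ofReal a * μ {x | ENNReal.ofReal a < T x} ≤
      ENNReal.ofReal A * ∫⁻ x in {x | ENNReal.ofReal (c * a) < g x}, g x ∂μ) :
    ∫⁻ x, T x ^ p ∂μ ≤
      ENNReal.ofReal (p * A * (c⁻¹ ^ (p - 1) / (p - 1))) * ∫⁻ x, g x ^ p ∂μ := by
  have hsup : ∀ x, T x ^ p = ⨆ n : ℕ, min (T x) n ^ p := by
    intro x
    have := (ENNReal.orderIsoRpow p (by linarith)).map_iSup (fun n : ℕ => min (T x) (n : ℝ≥0∞))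
    simp only [ENNReal.orderIsoRpow_apply] at this
    rw [← this, ← inf_iSup_eq, ENNReal.iSup_natCast, inf_top_eq]
  simp_rw [hsup]
  rw [lintegral_iSup (fun n => (hT.min measurable_const).pow_const p)]
  · exact iSup_le fun n => lintegral_min_rpow_le hp hA hc hT hg h n
  · intro m n hmn x
    exact ENNReal.rpow_le_rpow (min_le_min_left _ (by exact_mod_cast hmn)) (by linarith)

/-- The kernel `(1 + s²)⁻¹`, with values in `[0, ∞]`. -/
noncomputable def cauchyKernel (s : ℝ) : ℝ≥0∞ := ENNReal.ofReal (1 + s ^ 2)⁻¹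

/-- The average of `g` along the line through `x` in direction `e`, at scale `r`, against the
kernel `(1 + s²)⁻¹` (of total mass `π`). -/
noncomputable def lineAvg {E : Type*} [AddCommGroup E] [Module ℝ E] (e : E) (r : ℝ)
    (g : E → ℝ≥0∞) (x : E) : ℝ≥0∞ :=
  ∫⁻ s : ℝ, cauchyKernel s * g (x + (r * s) • e)

/-- The maximal function of the averages along lines in direction `e` at the scales `r n`. -/
noncomputable def lineMax {E : Type*} [AddCommGroup E] [Module ℝ E] (e : E) (r : ℕ → ℝ)
    (g : E → ℝ≥0∞) (x : E) : ℝ≥0∞ :=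
  ⨆ n, lineAvg e (r n) g x

@[fun_prop]
theorem measurable_cauchyKernel : Measurable cauchyKernel := by
  unfold cauchyKernel; fun_prop

theorem cauchyKernel_neg (s : ℝ) : cauchyKernel (-s) = cauchyKernel s := by
  simp [cauchyKernel]

section
variable {E : Type*} [AddCommGroup E] [Module ℝ E] [MeasurableSpace E] [MeasurableAdd₂ E]
  [MeasurableSMul₂ ℝ E] {e : E}

theorem measurable_lineAvg {r : ℝ} {g : E → ℝ≥0∞} (hg : Measurable g) :
    Measurable (lineAvg e r g) := by
  have : Measurable (Function.uncurry fun (x : E) (s : ℝ) =>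
      cauchyKernel s * g (x + (r * s) • e)) := by
    unfold Function.uncurry
    fun_prop
  exact this.lintegral_prod_right'

theorem measurable_lineMax {r : ℕ → ℝ} {g : E → ℝ≥0∞} (hg : Measurable g) :
    Measurable (lineMax e r g) :=
  Measurable.iSup fun _ => measurable_lineAvg hg

end

theorem lineAvg_le_lineMax {E : Type*} [AddCommGroup E] [Module ℝ E] (e : E) (r : ℕ → ℝ)
    (g : E → ℝ≥0∞) (x : E) (n : ℕ) : lineAvg e (r n) g x ≤ lineMax e r g x :=
  le_iSup (fun n => lineAvg e (r n) g x) n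

theorem ofReal_mul_lintegral_comp_add_mul {r : ℝ} (hr : 0 < r) (x : ℝ) {h : ℝ → ℝ≥0∞}
    (hh : Measurable h) : ENNReal.ofReal r * ∫⁻ s, h (x + r * s) = ∫⁻ y, h y := by
  rw [← lintegral_add_left_eq_self h x]
  nth_rewrite 2 [← Real.smul_map_volume_mul_left hr.ne']
  rw [lintegral_smul_measure, lintegral_map (by fun_prop) (by fun_prop), abs_of_pos hr, smul_eq_mul]

/-- The kernel is dominated by a sum of multiples of indicators of dyadic intervals, which reduces
its averages to averages over intervals. -/
theorem cauchyKernel_le_tsum (s : ℝ) :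
    cauchyKernel s ≤ ∑' k : ℕ, ENNReal.ofReal (4 * (1 / 4) ^ k) *
      Set.indicator (Metric.closedBall 0 ((2 : ℝ) ^ k)) 1 s := by
  obtain ⟨k, hk, hks⟩ : ∃ k : ℕ, |s| ≤ 2 ^ k ∧ (1 + s ^ 2)⁻¹ ≤ 4 * (1 / 4 : ℝ) ^ k := by
    by_cases hs : |s| ≤ 1
    · refine ⟨0, by simpa using hs, ?_⟩
      have : (1 + s ^ 2)⁻¹ ≤ 1 := inv_le_one_of_one_le₀ (by nlinarith [sq_nonneg s])
      norm_num
      linarith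
    · push Not at hs
      obtain ⟨n, h1, h2⟩ := exists_nat_pow_near hs.le (by norm_num : (1 : ℝ) < 2)
      refine ⟨n + 1, h2.le, ?_⟩
      have h3 : ((2 : ℝ) ^ n) ^ 2 ≤ s ^ 2 := by
        rw [← sq_abs s]; gcongr
      have h4 : ((2 : ℝ) ^ n) ^ 2 = 4 ^ n := by rw [← pow_mul, mul_comm, pow_mul]; norm_num
      rw [pow_succ, one_div, inv_pow]
      calc (1 + s ^ 2)⁻¹ ≤ ((4 : ℝ) ^ n)⁻¹ := by
            apply inv_anti₀ (by positivity); linarith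
        _ = _ := by ring
  refine le_trans ?_ (ENNReal.le_tsum k)
  rw [Set.indicator_of_mem (by simpa using hk), Pi.one_apply, mul_one]
  exact ENNReal.ofReal_le_ofReal hks

/-- If all averages of `g` over intervals around `x` are at most `a`, then so are, up to a
constant, the averages against the kernel `(1 + s²)⁻¹`. -/
theorem lineAvg_one_le {g : ℝ → ℝ≥0∞} (hg : Measurable g) {x : ℝ} {a : ℝ≥0∞}
    (h : ∀ R : ℝ, 0 < R → ∫⁻ y in Metric.closedBall x R, g y ≤ a * ENNReal.ofReal (2 * R))
    {r : ℝ} (hr : 0 < r) : lineAvg 1 r g x ≤ 16 * a := by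
  have hball : ∀ ρ : ℝ, 0 < ρ → ∫⁻ s, Set.indicator (Metric.closedBall 0 ρ) 1 s * g (x + r * s)
      ≤ a * ENNReal.ofReal (2 * ρ) := by
    intro ρ hρ
    have h1 : ∀ s, Set.indicator (Metric.closedBall 0 ρ) 1 s * g (x + r * s) =
        Set.indicator (Metric.closedBall x (r * ρ)) g (x + r * s) := by
      intro s
      have : s ∈ Metric.closedBall (0 : ℝ) ρ ↔ x + r * s ∈ Metric.closedBall x (r * ρ) := by
        simp [abs_of_pos hr, hr]
      by_cases hs : s ∈ Metric.closedBall (0 : ℝ) ρ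
      · rw [Set.indicator_of_mem hs, Set.indicator_of_mem (this.1 hs)]; simp
      · rw [Set.indicator_of_notMem hs, Set.indicator_of_notMem (mt this.2 hs)]; simp
    simp_rw [h1]
    have h2 := ofReal_mul_lintegral_comp_add_mul hr x
      (hg.indicator (Metric.isClosed_closedBall (x := x) (ε := r * ρ)).measurableSet)
    rw [lintegral_indicator Metric.isClosed_closedBall.measurableSet] at h2
    have h3 := h (r * ρ) (by positivity)
    rw [← h2, show 2 * (r * ρ) = r * (2 * ρ) by ring, ENNReal.ofReal_mul hr.le,
      mul_left_comm] at h3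
    exact (ENNReal.mul_le_mul_iff_right (ENNReal.ofReal_pos.2 hr).ne' ENNReal.ofReal_ne_top).1 h3
  have hm : ∀ k : ℕ, Measurable fun s : ℝ => Set.indicator (Metric.closedBall (0 : ℝ) (2 ^ k)) (1 : ℝ → ℝ≥0∞) s
      * g (x + r * s) := fun k =>
    (measurable_one.indicator Metric.isClosed_closedBall.measurableSet).mul (by fun_prop)
  calc lineAvg 1 r g x
      ≤ ∫⁻ s, ∑' k : ℕ, ENNReal.ofReal (4 * (1 / 4) ^ k) *
          (Set.indicator (Metric.closedBall 0 ((2 : ℝ) ^ k)) 1 s * g (x + r * s)) := by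
        refine lintegral_mono fun s => ?_
        simp_rw [← mul_assoc]
        rw [ENNReal.tsum_mul_right, smul_eq_mul, mul_one]
        gcongr
        exact cauchyKernel_le_tsum s
    _ = ∑' k : ℕ, ENNReal.ofReal (4 * (1 / 4) ^ k) *
          ∫⁻ s, Set.indicator (Metric.closedBall 0 ((2 : ℝ) ^ k)) 1 s * g (x + r * s) := by
        rw [lintegral_tsum (fun k => ((hm k).const_mul _).aemeasurable)]
        congr with k
        rw [lintegral_const_mul _ (hm k)]
    _ ≤ ∑' k : ℕ, ENNReal.ofReal (4 * (1 / 4) ^ k) * (a * ENNReal.ofReal (2 * 2 ^ k)) := by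
        gcongr with k
        exact hball _ (by positivity)
    _ = (∑' k : ℕ, ENNReal.ofReal (8 * (1 / 2) ^ k)) * a := by
        rw [← ENNReal.tsum_mul_right]
        congr with k
        rw [mul_left_comm, ← ENNReal.ofReal_mul (by positivity), mul_comm]
        congr 2
        rw [show (1 / 4 : ℝ) = 1 / 2 * (1 / 2) by norm_num, mul_pow, one_div, inv_pow]
        field_simp
        ring
    _ = 16 * a := by
        congr 1
        rw [← ENNReal.ofReal_tsum_of_nonneg (fun k => by positivity)
          ((summable_geometric_two).mul_left 8), tsum_mul_left, tsum_geometric_two]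
        norm_num

theorem lineAvg_add {g h : ℝ → ℝ≥0∞} (hg : Measurable g) {r x : ℝ} :
    lineAvg 1 r (fun y => g y + h y) x = lineAvg 1 r g x + lineAvg 1 r h x := by
  unfold lineAvg
  simp_rw [mul_add]
  rw [lintegral_add_left (by fun_prop)]

/-- The maximal function on the line is bounded on `L^p`: the part of `g` below a fixed multiple
of the height `a` does not contribute to the level set, which refines the weak type bound. -/
theorem lintegral_lineMax_one_rpow_le {p : ℝ} (hp : 1 < p) : ∃ C : ℝ, 0 ≤ C ∧
    ∀ (r : ℕ → ℝ), (∀ n, 0 < r n) → ∀ g : ℝ → ℝ≥0∞, Measurable g →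
      ∫⁻ x, lineMax 1 r g x ^ p ≤ ENNReal.ofReal C * ∫⁻ x, g x ^ p := by
  refine ⟨p * 160 * ((1 / 32)⁻¹ ^ (p - 1) / (p - 1)), ?_, fun r hr g hg => ?_⟩
  · have : 0 < p - 1 := by linarith
    positivity
  refine lintegral_rpow_le_of_weak_type hp (by norm_num) (by norm_num) (measurable_lineMax hg) hg
    fun a ha => ?_
  set U : Set ℝ := {x | ENNReal.ofReal (1 / 32 * a) < g x} with hU
  have hUm : MeasurableSet U := measurableSet_lt measurable_const hg
  have hsub : {x | ENNReal.ofReal a < lineMax 1 r g x} ⊆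
      {x : ℝ | ∃ R : ℝ, 0 < R ∧ ENNReal.ofReal (a / 32) * ENNReal.ofReal (2 * R) <
        ∫⁻ y in Metric.closedBall x R, U.indicator g y} := by
    intro x hx
    by_contra hcon
    simp only [Set.mem_ofPred_eq, not_exists, not_and, not_lt] at hcon
    refine absurd (show ENNReal.ofReal a < lineMax 1 r g x from hx) (not_lt.2 (iSup_le fun n => ?_))
    have h1 : lineAvg 1 (r n) (U.indicator g) x ≤ 16 * ENNReal.ofReal (a / 32) :=
      lineAvg_one_le (hg.indicator hUm) hcon (hr n)
    have h2 : lineAvg 1 (r n) (fun _ => ENNReal.ofReal (a / 32)) x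
        ≤ 16 * ENNReal.ofReal (a / 32) := by
      refine lineAvg_one_le measurable_const (fun R hR => ?_) (hr n)
      rw [setLIntegral_const, Real.volume_closedBall]
    calc lineAvg 1 (r n) g x
        ≤ lineAvg 1 (r n) (fun y => U.indicator g y + ENNReal.ofReal (a / 32)) x := by
          unfold lineAvg
          gcongr with s
          beta_reduce
          by_cases hy : x + (r n * s) • 1 ∈ U
          · rw [Set.indicator_of_mem hy]; exact le_self_add
          · rw [Set.indicator_of_notMem hy, zero_add]
            have : g (x + (r n * s) • 1) ≤ ENNReal.ofReal (1 / 32 * a) := not_lt.1 hy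
            rwa [show 1 / 32 * a = a / 32 by ring] at this
      _ ≤ 16 * ENNReal.ofReal (a / 32) + 16 * ENNReal.ofReal (a / 32) := by
          rw [lineAvg_add (hg.indicator hUm)]
          gcongr
      _ = ENNReal.ofReal a := by
          rw [← add_mul, show (16 : ℝ≥0∞) + 16 = ENNReal.ofReal 32 by norm_num,
            ← ENNReal.ofReal_mul (by norm_num)]
          congr 1; ring
  have hweak := mul_volume_setOf_lt_lintegral_closedBall_le (U.indicator g)
    (a := ENNReal.ofReal (a / 32)) (ENNReal.ofReal_pos.2 (by positivity)).ne' ENNReal.ofReal_ne_top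
  rw [lintegral_indicator hUm] at hweak
  calc ENNReal.ofReal a * volume {x | ENNReal.ofReal a < lineMax 1 r g x}
      = ENNReal.ofReal 32 * (ENNReal.ofReal (a / 32) *
          volume {x | ENNReal.ofReal a < lineMax 1 r g x}) := by
        rw [← mul_assoc, ← ENNReal.ofReal_mul (by norm_num), mul_div_cancel₀ _ (by norm_num)]
    _ ≤ ENNReal.ofReal 32 * (5 * ∫⁻ x in U, g x) :=
        mul_le_mul_right ((mul_le_mul_right (measure_mono hsub) _).trans hweak) _
    _ = _ := by
        rw [← mul_assoc]
        congr 1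
        rw [show (5 : ℝ≥0∞) = ENNReal.ofReal 5 by norm_num, ← ENNReal.ofReal_mul (by norm_num)]
        norm_num

/-- The unit vector of the first coordinate. -/
noncomputable def firstAxis (d : ℕ) [NeZero d] : EuclideanSpace ℝ (Fin d) :=
  EuclideanSpace.single 0 1

/-- The maximal function along the first coordinate axis is bounded on `L^p(ℝ^d)`, by slicing into
lines. -/
theorem lintegral_lineMax_rpow_le {p : ℝ} (hp : 1 < p) : ∃ C : ℝ, 0 ≤ C ∧
    ∀ (d : ℕ) [NeZero d] (r : ℕ → ℝ), (∀ n, 0 < r n) →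
      ∀ g : EuclideanSpace ℝ (Fin d) → ℝ≥0∞, Measurable g →
      ∫⁻ x, lineMax (firstAxis d) r g x ^ p ≤ ENNReal.ofReal C * ∫⁻ x, g x ^ p := by
  obtain ⟨C, hC, h⟩ := lintegral_lineMax_one_rpow_le hp
  refine ⟨C, hC, fun d _ r hr g hg => ?_⟩
  obtain ⟨n, rfl⟩ := Nat.exists_eq_succ_of_ne_zero (NeZero.ne d)
  let T : EuclideanSpace ℝ (Fin (n + 1)) ≃ᵐ ℝ × (Fin n → ℝ) :=
    (MeasurableEquiv.toLp 2 (Fin (n + 1) → ℝ)).symm.trans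
      (MeasurableEquiv.piFinSuccAbove (fun _ => ℝ) 0)
  have hT : MeasurePreserving T :=
    (EuclideanSpace.volume_preserving_symm_measurableEquiv_toLp (Fin (n + 1))).trans
      (volume_preserving_piFinSuccAbove (fun _ => ℝ) 0)
  have hslice : ∀ f : EuclideanSpace ℝ (Fin (n + 1)) → ℝ≥0∞, Measurable f →
      ∫⁻ x, f x = ∫⁻ y, ∫⁻ t, f (T.symm (t, y)) := by
    intro f hf
    rw [← hT.symm.lintegral_comp hf, Measure.volume_eq_prod,
      lintegral_prod_symm' (fun z => f (T.symm z)) (hf.comp T.symm.measurable)]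
  have hshift : ∀ t s : ℝ, ∀ y, T.symm (t, y) + s • firstAxis (n + 1) = T.symm (t + s, y) := by
    intro t s y
    ext i
    refine Fin.cases ?_ (fun j => ?_) i
    · simp [T, firstAxis, MeasurableEquiv.piFinSuccAbove]
    · simp [T, firstAxis, MeasurableEquiv.piFinSuccAbove]
  have hmax : ∀ t y, lineMax (firstAxis (n + 1)) r g (T.symm (t, y)) =
      lineMax 1 r (fun t => g (T.symm (t, y))) t := by
    intro t y
    simp only [lineMax, lineAvg, hshift, smul_eq_mul, mul_one]
  rw [hslice _ ((measurable_lineMax hg).pow_const p), hslice _ (hg.pow_const p),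
    ← lintegral_const_mul]
  · refine lintegral_mono fun y => ?_
    simp_rw [hmax]
    exact h r hr _ (by fun_prop)
  · exact Measurable.lintegral_prod_left' (f := fun z : ℝ × (Fin n → ℝ) => g (T.symm z) ^ p)
      (by fun_prop)

theorem lintegral_cauchyKernel : ∫⁻ s, cauchyKernel s = ENNReal.ofReal Real.pi := by
  unfold cauchyKernel
  rw [← integral_univ_inv_one_add_sq, ofReal_integral_eq_lintegral_ofReal integrable_inv_one_add_sq]
  exact Filter.Eventually.of_forall fun s => by positivity

section
variable {E : Type*} [AddCommGroup E] [Module ℝ E] [MeasurableSpace E] [MeasurableAdd₂ E]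
  [MeasurableSMul₂ ℝ E] {e : E}

/-- The Cauchy-Schwarz inequality for averages along a line. -/
theorem lineAvg_sq_le {r : ℝ} {g : E → ℝ≥0∞} (hg : Measurable g) (x : E) :
    lineAvg e r g x ^ 2 ≤ ENNReal.ofReal Real.pi * lineAvg e r (fun y => g y ^ 2) x := by
  have h := ENNReal.lintegral_mul_le_Lp_mul_Lq (volume.withDensity cauchyKernel)
    Real.HolderConjugate.two_two (f := fun _ => 1) (g := fun s : ℝ => g (x + (r * s) • e))
    aemeasurable_const (by fun_prop)
  have h2 : lineAvg e r g x ≤ ENNReal.ofReal Real.pi ^ (1 / 2 : ℝ) *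
      lineAvg e r (fun y => g y ^ 2) x ^ (1 / 2 : ℝ) := by
    convert h using 2
    · rw [lintegral_withDensity_eq_lintegral_mul _ measurable_cauchyKernel (by fun_prop)]
      simp [lineAvg]
    · simp [lintegral_cauchyKernel]
    · rw [lintegral_withDensity_eq_lintegral_mul _ measurable_cauchyKernel (by fun_prop)]
      simp [lineAvg]
  calc lineAvg e r g x ^ 2 ≤ (ENNReal.ofReal Real.pi ^ (1 / 2 : ℝ) *
      lineAvg e r (fun y => g y ^ 2) x ^ (1 / 2 : ℝ)) ^ 2 := by gcongr
    _ = _ := by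
      rw [mul_pow, ← ENNReal.rpow_mul_natCast, ← ENNReal.rpow_mul_natCast]
      norm_num

/-- Averages along lines are self-adjoint, since the kernel is even. -/
theorem lintegral_lineAvg_mul {μ : Measure E} [SFinite μ] [μ.IsAddRightInvariant] {r : ℝ}
    {g w : E → ℝ≥0∞} (hg : Measurable g) (hw : Measurable w) :
    ∫⁻ x, lineAvg e r g x * w x ∂μ = ∫⁻ x, g x * lineAvg e r w x ∂μ := by
  have h1 : ∀ x, lineAvg e r g x * w x = ∫⁻ s, cauchyKernel s * (g (x + (r * s) • e) * w x) := by
    intro x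
    rw [lineAvg, ← lintegral_mul_const _ (by fun_prop)]
    simp_rw [mul_assoc]
  have h2 : ∀ x, g x * lineAvg e r w x = ∫⁻ s, cauchyKernel s * (g x * w (x + (r * s) • e)) := by
    intro x
    rw [lineAvg, ← lintegral_const_mul _ (by fun_prop)]
    simp_rw [mul_left_comm]
  simp_rw [h1, h2]
  refine (lintegral_lintegral_swap (by unfold Function.uncurry; fun_prop)).trans
    (Eq.trans ?_ (lintegral_lintegral_swap (by unfold Function.uncurry; fun_prop)).symm)
  rw [← lintegral_neg_eq_self (μ := (volume : Measure ℝ))]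
  refine lintegral_congr fun s => ?_
  rw [cauchyKernel_neg, lintegral_const_mul _ (by fun_prop), lintegral_const_mul _ (by fun_prop),
    ← lintegral_add_right_eq_self _ ((r * s) • e)]
  simp

end

/-! ### Oscillatory integrals and multipliers in one direction -/

section
variable {E : Type*} [NormedAddCommGroup E] [InnerProductSpace ℝ E]

/-- The function with Fourier transform `h dt` on the curve `Γ`:
`x ↦ ∫ e^{i⟨x, Γ(t)⟩} h(t) dt`. -/
noncomputable def oscInt (Γ : ℝ → E) (h : ℝ → ℂ) (x : E) : ℂ :=
  ∫ t, Complex.exp (Complex.I * ((inner ℝ x (Γ t) : ℝ) : ℂ)) * h t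

theorem norm_exp_I_mul_ofReal (a : ℝ) : ‖Complex.exp (Complex.I * (a : ℂ))‖ = 1 := by
  rw [mul_comm, Complex.norm_exp_ofReal_mul_I]

variable {Γ : ℝ → E} {h : ℝ → ℂ} {e : E}

theorem integrable_osc (hΓ : Continuous Γ) (hh : Integrable h) (x : E) :
    Integrable fun t => Complex.exp (Complex.I * ((inner ℝ x (Γ t) : ℝ) : ℂ)) * h t := by
  refine hh.bdd_mul (c := 1) (Continuous.aestronglyMeasurable (by fun_prop)) ?_
  exact Filter.Eventually.of_forall fun t => (norm_exp_I_mul_ofReal _).le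

theorem continuous_oscInt (hΓ : Continuous Γ) (hh : Integrable h) : Continuous (oscInt Γ h) := by
  refine continuous_of_dominated (bound := fun t => ‖h t‖)
    (fun x => (integrable_osc hΓ hh x).aestronglyMeasurable) (fun x => ?_) hh.norm ?_
  · exact Filter.Eventually.of_forall fun t => by rw [norm_mul, norm_exp_I_mul_ofReal, one_mul]
  · exact Filter.Eventually.of_forall fun t => by fun_prop

theorem oscInt_finset_sum {ι : Type*} (s : Finset ι) {h : ι → ℝ → ℂ} (hΓ : Continuous Γ)
    (hh : ∀ i ∈ s, Integrable (h i)) (x : E) :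
    oscInt Γ (fun t => ∑ i ∈ s, h i t) x = ∑ i ∈ s, oscInt Γ (h i) x := by
  unfold oscInt
  simp_rw [Finset.mul_sum]
  exact integral_finsetSum s fun i hi => integrable_osc hΓ (hh i hi) x

theorem hasLineDerivAt_oscInt (hΓ : Continuous Γ) (hh : Integrable h)
    (hh' : Integrable fun t => Complex.I * ((inner ℝ e (Γ t) : ℝ) : ℂ) * h t) (x : E) :
    HasLineDerivAt ℝ (oscInt Γ h)
      (oscInt Γ (fun t => Complex.I * ((inner ℝ e (Γ t) : ℝ) : ℂ) * h t) x) x e := by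
  unfold HasLineDerivAt
  have key := hasDerivAt_integral_of_dominated_loc_of_deriv_le (μ := volume) (x₀ := (0 : ℝ))
    (F := fun (s : ℝ) t => Complex.exp (Complex.I * ((inner ℝ (x + s • e) (Γ t) : ℝ) : ℂ)) * h t)
    (F' := fun (s : ℝ) t => Complex.exp (Complex.I * ((inner ℝ (x + s • e) (Γ t) : ℝ) : ℂ)) *
      (Complex.I * ((inner ℝ e (Γ t) : ℝ) : ℂ) * h t))
    (s := Set.univ) (bound := fun t => ‖Complex.I * ((inner ℝ e (Γ t) : ℝ) : ℂ) * h t‖)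
    Filter.univ_mem
    (Filter.Eventually.of_forall fun s => (integrable_osc hΓ hh _).aestronglyMeasurable)
    (integrable_osc hΓ hh _) (integrable_osc hΓ hh' _).aestronglyMeasurable
    (Filter.Eventually.of_forall fun t s _ => ?_) hh'.norm
    (Filter.Eventually.of_forall fun t s _ => ?_)
  · have := key.2
    simp only [zero_smul, add_zero] at this
    exact this
  · rw [norm_mul, norm_exp_I_mul_ofReal, one_mul]
  · have h1 : HasDerivAt (fun s : ℝ => ((inner ℝ (x + s • e) (Γ t) : ℝ) : ℂ))
        ((inner ℝ e (Γ t) : ℝ) : ℂ) s := by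
      simp_rw [inner_add_left, inner_smul_left]
      apply HasDerivAt.ofReal_comp
      simpa using ((hasDerivAt_id s).mul_const (inner ℝ e (Γ t))).const_add (inner ℝ x (Γ t))
    refine ((h1.const_mul Complex.I).cexp.mul_const (h t)).congr_deriv ?_
    ring

/-- A smooth compactly supported multiplier on the line is convolution with a kernel that is
dominated by `(1 + s²)⁻¹`. -/
theorem exists_kernel {φ : ℝ → ℂ} (hφ : ContDiff ℝ ∞ φ) (hφc : HasCompactSupport φ) :
    ∃ k : ℝ → ℂ, Continuous k ∧ ∃ A : ℝ, 0 ≤ A ∧ (∀ s, ‖k s‖ ≤ A * (1 + s ^ 2)⁻¹) ∧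
      ∀ ξ : ℝ, ∫ s, k s * Complex.exp (Complex.I * ((s * ξ : ℝ) : ℂ)) = φ ξ := by
  -- Rescaling removes the factor `2π` from the normalization of the Fourier transform.
  set φ₁ : ℝ → ℂ := fun η => φ ((2 * Real.pi) * η) with hφ₁
  have hc : HasCompactSupport φ₁ :=
    hφc.comp_homeomorph (Homeomorph.mulLeft₀ (2 * Real.pi) (by positivity))
  have hs : ContDiff ℝ ∞ φ₁ := hφ.comp (by fun_prop)
  set f : SchwartzMap ℝ ℂ := hc.toSchwartzMap hs with hf
  set ψ : SchwartzMap ℝ ℂ := FourierTransform.fourier f with hψ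
  obtain ⟨C0, hC0p, hC0⟩ := ψ.decay 0 0
  obtain ⟨C2, hC2p, hC2⟩ := ψ.decay 2 0
  refine ⟨ψ, ψ.continuous, C0 + C2, by linarith, fun s => ?_, fun ξ => ?_⟩
  · have h0 := hC0 s
    have h2 := hC2 s
    simp only [norm_iteratedFDeriv_zero, pow_zero, one_mul, Real.norm_eq_abs, sq_abs] at h0 h2
    rw [← div_eq_mul_inv, le_div_iff₀ (by positivity)]
    linarith
  · have hinv : FourierTransformInv.fourierInv ψ = f := by
      rw [hψ]; exact FourierTransform.fourierInv_fourier_eq f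
    have h1 : FourierTransformInv.fourierInv (ψ : ℝ → ℂ) (ξ / (2 * Real.pi)) = φ ξ := by
      rw [← SchwartzMap.fourierInv_coe, hinv]
      change φ₁ _ = _
      simp only [hφ₁]
      congr 1
      field_simp
    rw [← h1, Real.fourierInv_eq']
    refine integral_congr_ae (Filter.Eventually.of_forall fun s => ?_)
    simp only [smul_eq_mul]
    rw [mul_comm]
    congr 2
    simp
    field_simp

/-- A multiplier in direction `e` acts on an oscillatory integral by convolution along `e`. -/
theorem integral_kernel_mul_oscInt {k : ℝ → ℂ} (hk : Continuous k) {A : ℝ}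
    (hkA : ∀ s, ‖k s‖ ≤ A * (1 + s ^ 2)⁻¹) {φ : ℝ → ℂ}
    (hφ : ∀ ξ : ℝ, ∫ s, k s * Complex.exp (Complex.I * ((s * ξ : ℝ) : ℂ)) = φ ξ)
    (hΓ : Continuous Γ) (hh : Integrable h) (r : ℝ) (x : E) :
    ∫ s, k s * oscInt Γ h (x + (r * s) • e) =
      oscInt Γ (fun t => φ (r * inner ℝ e (Γ t)) * h t) x := by
  have hkint : Integrable k :=
    (integrable_inv_one_add_sq.const_mul A).mono' hk.aestronglyMeasurable
      (Filter.Eventually.of_forall hkA)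
  have hexp : ∀ s t, Complex.exp (Complex.I * ((inner ℝ (x + (r * s) • e) (Γ t) : ℝ) : ℂ)) =
      Complex.exp (Complex.I * ((inner ℝ x (Γ t) : ℝ) : ℂ)) *
        Complex.exp (Complex.I * ((s * (r * inner ℝ e (Γ t)) : ℝ) : ℂ)) := by
    intro s t
    rw [← Complex.exp_add, inner_add_left, inner_smul_left]
    congr 1
    push_cast
    simp only [conj_trivial]
    push_cast
    ring
  unfold oscInt
  simp_rw [← integral_const_mul]
  rw [integral_integral_swap]
  · refine integral_congr_ae (Filter.Eventually.of_forall fun t => ?_)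
    simp only
    rw [← hφ (r * inner ℝ e (Γ t)), ← integral_mul_const, ← integral_const_mul]
    refine integral_congr_ae (Filter.Eventually.of_forall fun s => ?_)
    simp only [hexp]
    ring
  · refine (hkint.mul_prod hh).mono ?_ (Filter.Eventually.of_forall fun z => ?_)
    · have h1 : AEStronglyMeasurable (fun z : ℝ × ℝ => k z.1) (volume.prod volume) :=
        Continuous.aestronglyMeasurable (by fun_prop)
      have h2 : AEStronglyMeasurable (fun z : ℝ × ℝ => Complex.exp (Complex.I *
          ((inner ℝ (x + (r * z.1) • e) (Γ z.2) : ℝ) : ℂ))) (volume.prod volume) :=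
        Continuous.aestronglyMeasurable (by fun_prop)
      exact h1.mul (h2.mul hh.aestronglyMeasurable.comp_snd)
    · simp only [Function.uncurry, norm_mul, norm_exp_I_mul_ofReal, one_mul, le_refl]

/-- Pointwise domination of a multiplier in direction `e` by averages along `e`. -/
theorem enorm_oscInt_mul_le {k : ℝ → ℂ} (hk : Continuous k) {A : ℝ}
    (hkA : ∀ s, ‖k s‖ ≤ A * (1 + s ^ 2)⁻¹) {φ : ℝ → ℂ}
    (hφ : ∀ ξ : ℝ, ∫ s, k s * Complex.exp (Complex.I * ((s * ξ : ℝ) : ℂ)) = φ ξ)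
    (hΓ : Continuous Γ) (hh : Integrable h) (r : ℝ) (x : E) :
    ‖oscInt Γ (fun t => φ (r * inner ℝ e (Γ t)) * h t) x‖ₑ ≤
      ENNReal.ofReal A * lineAvg e r (fun y => ‖oscInt Γ h y‖ₑ) x := by
  have hA : 0 ≤ A := by simpa using (norm_nonneg _).trans (hkA 0)
  rw [← integral_kernel_mul_oscInt hk hkA hφ hΓ hh r x]
  refine (enorm_integral_le_lintegral_enorm _).trans ?_
  rw [lineAvg, ← lintegral_const_mul' _ _ ENNReal.ofReal_ne_top]
  refine lintegral_mono fun s => ?_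
  simp only
  rw [enorm_mul, ← mul_assoc]
  gcongr
  rw [cauchyKernel, ← ENNReal.ofReal_mul hA, ← ofReal_norm]
  exact ENNReal.ofReal_le_ofReal (hkA s)

end

/-! ### The duality map `z ↦ ‖z‖ᵖ z` and a second order Taylor inequality -/

section
variable {V : Type*} [NormedAddCommGroup V] [InnerProductSpace ℝ V]

/-- The derivative of `z ↦ ‖z‖ᵖ z`. -/
noncomputable def rpowSMulDeriv (p : ℝ) (z : V) : V →L[ℝ] V :=
  (‖z‖ ^ p) • ContinuousLinearMap.id ℝ V + (p * ‖z‖ ^ (p - 2)) • (innerSL ℝ z).smulRight z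

theorem hasFDerivAt_norm_rpow_smul {p : ℝ} (hp : 0 < p) (z : V) :
    HasFDerivAt (fun z : V => ‖z‖ ^ p • z) (rpowSMulDeriv p z) z := by
  by_cases hz : z = 0
  · subst hz
    have h0 : rpowSMulDeriv p (0 : V) = 0 := by
      ext v
      simp [rpowSMulDeriv, Real.zero_rpow hp.ne']
    rw [h0, hasFDerivAt_iff_isLittleO_nhds_zero]
    simp only [zero_add, smul_zero, sub_zero, zero_apply]
    have h1 : Filter.Tendsto (fun z : V => ‖z‖ ^ p) (nhds 0) (nhds 0) := by
      have : Continuous fun z : V => ‖z‖ ^ p := continuous_norm.rpow_const fun _ => Or.inr hp.le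
      simpa [Real.zero_rpow hp.ne'] using this.tendsto 0
    have h2 := ((Asymptotics.isLittleO_one_iff ℝ).2 h1).smul_isBigO
      (Asymptotics.isBigO_refl (fun z : V => z) (nhds 0))
    simpa using h2
  · have hz' : 0 < ‖z‖ := norm_pos_iff.2 hz
    have h1 : HasFDerivAt (fun z : V => ‖z‖ ^ p) ((p * ‖z‖ ^ (p - 2)) • innerSL ℝ z) z := by
      have h2 := (hasStrictFDerivAt_norm_sq z).hasFDerivAt.rpow_const (p := p / 2)
        (Or.inl (by positivity))
      have h3 : (fun z : V => (‖z‖ ^ 2) ^ (p / 2)) = fun z : V => ‖z‖ ^ p := by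
        ext y
        rw [← Real.rpow_natCast, ← Real.rpow_mul (norm_nonneg _)]
        congr 1; push_cast; ring
      rw [h3] at h2
      refine h2.congr_fderiv ?_
      rw [← Real.rpow_natCast ‖z‖ 2, ← Real.rpow_mul (norm_nonneg _)]
      ext v
      simp only [smul_apply, smul_eq_mul, nsmul_eq_mul]
      have : ((2 : ℕ) : ℝ) * (p / 2 - 1) = p - 2 := by push_cast; ring
      rw [this]
      push_cast
      simp
      ring
    refine (h1.fun_smul (hasFDerivAt_id z)).congr_fderiv ?_
    ext v
    simp [rpowSMulDeriv, mul_smul]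

theorem norm_rpowSMulDeriv_apply_le {p : ℝ} (hp : 0 < p) (z v : V) :
    ‖rpowSMulDeriv p z v‖ ≤ (1 + p) * ‖z‖ ^ p * ‖v‖ := by
  by_cases hz : z = 0
  · subst hz
    simp [rpowSMulDeriv, Real.zero_rpow hp.ne']
  · have hz' : 0 < ‖z‖ := norm_pos_iff.2 hz
    have h1 : ‖z‖ ^ (p - 2) * (‖z‖ * ‖z‖) = ‖z‖ ^ p := by
      rw [← sq, ← Real.rpow_natCast, ← Real.rpow_add hz']
      congr 1; push_cast; ring
    calc ‖rpowSMulDeriv p z v‖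
        = ‖‖z‖ ^ p • v + (p * ‖z‖ ^ (p - 2)) • (inner ℝ z v : ℝ) • z‖ := by
          simp [rpowSMulDeriv]
      _ ≤ ‖z‖ ^ p * ‖v‖ + (p * ‖z‖ ^ (p - 2)) * ((‖z‖ * ‖v‖) * ‖z‖) := by
          refine (norm_add_le _ _).trans ?_
          rw [norm_smul, norm_smul, norm_smul, Real.norm_of_nonneg (by positivity),
            Real.norm_of_nonneg (by positivity)]
          gcongr
          exact norm_inner_le_norm z v
      _ = ‖z‖ ^ p * ‖v‖ + p * (‖z‖ ^ (p - 2) * (‖z‖ * ‖z‖)) * ‖v‖ := by ring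
      _ = _ := by rw [h1]; ring

theorem norm_rpow_smul_sub_le {p : ℝ} (hp : 0 < p) {R : ℝ} {z w : V} (hz : ‖z‖ ≤ R) (hw : ‖w‖ ≤ R) :
    ‖‖w‖ ^ p • w - ‖z‖ ^ p • z‖ ≤ (1 + p) * R ^ p * ‖w - z‖ := by
  refine (convex_closedBall (0 : V) R).norm_image_sub_le_of_norm_hasFDerivWithin_le
    (f := fun z : V => ‖z‖ ^ p • z) (f' := rpowSMulDeriv p)
    (fun x _ => (hasFDerivAt_norm_rpow_smul hp x).hasFDerivWithinAt) (fun x hx => ?_)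
    (by simpa using hz) (by simpa using hw)
  have hR : 0 ≤ R := (norm_nonneg z).trans hz
  refine ContinuousLinearMap.opNorm_le_bound _ (by positivity) fun v => ?_
  refine (norm_rpowSMulDeriv_apply_le hp x v).trans ?_
  have : ‖x‖ ≤ R := by simpa using hx
  gcongr

/-- The second order Taylor inequality for `z ↦ ‖z‖^q`, `q > 2`, from the mean value theorem and
the Lipschitz bound `norm_rpow_smul_sub_le` for its gradient. -/
theorem norm_add_rpow_le {q : ℝ} (hq : 2 < q) (z w : V) :
    ‖z + w‖ ^ q ≤ ‖z‖ ^ q + q * inner ℝ (‖z‖ ^ (q - 2) • z) w +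
      q * (q - 1) * ((‖z‖ + ‖w‖) ^ (q - 2) * ‖w‖ ^ 2) := by
  have hder : ∀ s : ℝ, HasDerivAt (fun s : ℝ => ‖z + s • w‖ ^ q)
      (q * inner ℝ (‖z + s • w‖ ^ (q - 2) • (z + s • w)) w) s := by
    intro s
    have h1 : HasDerivAt (fun s : ℝ => z + s • w) w s := by
      simpa using ((hasDerivAt_id s).smul_const w).const_add z
    have h2 := (hasFDerivAt_norm_rpow (z + s • w) (by linarith : 1 < q)).comp_hasDerivAt s h1
    refine h2.congr_deriv ?_
    rw [inner_smul_left]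
    simp only [smul_apply, innerSL_apply_apply, smul_eq_mul, conj_trivial]
    ring
  obtain ⟨c, hc, hcs⟩ := exists_hasDerivAt_eq_slope (fun s : ℝ => ‖z + s • w‖ ^ q) _
    zero_lt_one (fun s _ => (hder s).continuousAt.continuousWithinAt) (fun s _ => hder s)
  simp only [one_smul, zero_smul, add_zero, sub_zero, div_one] at hcs
  have hcw : ‖c • w‖ ≤ ‖w‖ := by
    rw [norm_smul, Real.norm_of_nonneg hc.1.le]
    exact mul_le_of_le_one_left (norm_nonneg _) hc.2.le
  have h3 := norm_rpow_smul_sub_le (p := q - 2) (by linarith) (R := ‖z‖ + ‖w‖) (z := z)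
    (w := z + c • w) (by linarith [norm_nonneg w]) ((norm_add_le _ _).trans (by gcongr))
  have h4 : inner ℝ (‖z + c • w‖ ^ (q - 2) • (z + c • w) - ‖z‖ ^ (q - 2) • z) w ≤
      (q - 1) * ((‖z‖ + ‖w‖) ^ (q - 2) * ‖w‖ ^ 2) := by
    refine (real_inner_le_norm _ _).trans ?_
    calc _ ≤ ((1 + (q - 2)) * (‖z‖ + ‖w‖) ^ (q - 2) * ‖w‖) * ‖w‖ := by
          gcongr
          refine h3.trans ?_
          rw [add_sub_cancel_left]
          have : 0 < q - 2 := by linarith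
          gcongr
      _ = _ := by ring
  rw [inner_sub_left] at h4
  have hq0 : 0 < q := by linarith
  nlinarith [mul_le_mul_of_nonneg_left h4 hq0.le]

theorem add_rpow_le_two_rpow_mul {q : ℝ} (hq : 0 < q) {a b : ℝ} (ha : 0 ≤ a) (hb : 0 ≤ b) :
    (a + b) ^ q ≤ 2 ^ q * (a ^ q + b ^ q) := by
  have hA := Real.rpow_nonneg ha q
  have hB := Real.rpow_nonneg hb q
  calc (a + b) ^ q ≤ (2 * max a b) ^ q := by
        gcongr
        linarith [le_max_left a b, le_max_right a b]
    _ = 2 ^ q * max a b ^ q := Real.mul_rpow (by norm_num) (ha.trans (le_max_left _ _))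
    _ ≤ _ := by
        gcongr
        rcases max_choice a b with h | h <;> rw [h] <;> linarith

theorem rpow_mul_mul_le {q : ℝ} (hq : 2 < q) {a b c : ℝ} (ha : 0 ≤ a) (hb : 0 ≤ b) (hc : 0 ≤ c) :
    a ^ (q - 2) * (b * c) ≤ a ^ q + b ^ q + c ^ q := by
  set m := max a (max b c) with hm
  have ham : a ≤ m := le_max_left _ _
  have hbm : b ≤ m := (le_max_left _ _).trans (le_max_right _ _)
  have hcm : c ≤ m := (le_max_right _ _).trans (le_max_right _ _)
  have hm0 : 0 ≤ m := ha.trans ham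
  have hp : 0 < q - 2 := by linarith
  have h1 : a ^ (q - 2) * (b * c) ≤ m ^ q := by
    calc a ^ (q - 2) * (b * c) ≤ m ^ (q - 2) * (m * m) := by gcongr
      _ = m ^ q := by
        rw [← sq, ← Real.rpow_natCast, ← Real.rpow_add_of_nonneg hm0 hp.le (by norm_num)]
        congr 1; push_cast; ring
  have h2 : m ^ q ≤ a ^ q + b ^ q + c ^ q := by
    have hA := Real.rpow_nonneg ha q
    have hB := Real.rpow_nonneg hb q
    have hC := Real.rpow_nonneg hc q
    rcases max_choice a (max b c) with h | h
    · rw [hm, h]; linarith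
    · rcases max_choice b c with h' | h' <;> rw [hm, h, h'] <;> linarith
  exact h1.trans h2

end

theorem integrable_norm_rpow_mul_mul {E V : Type*} [TopologicalSpace E] [MeasurableSpace E]
    [BorelSpace E] {μ : Measure E} [NormedAddCommGroup V] {q : ℝ} (hq : 2 < q) {f g h : E → V} (hf : Continuous f)
    (hg : Continuous g) (hh : Continuous h) (hfq : Integrable (fun x => ‖f x‖ ^ q) μ)
    (hgq : Integrable (fun x => ‖g x‖ ^ q) μ) (hhq : Integrable (fun x => ‖h x‖ ^ q) μ) :
    Integrable (fun x => ‖f x‖ ^ (q - 2) * (‖g x‖ * ‖h x‖)) μ := by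
  refine ((hfq.add hgq).add hhq).mono' ?_ (Filter.Eventually.of_forall fun x => ?_)
  · have : Continuous fun x => ‖f x‖ ^ (q - 2) :=
      hf.norm.rpow_const fun _ => Or.inr (by linarith)
    exact (this.mul (hg.norm.mul hh.norm)).aestronglyMeasurable
  · rw [Real.norm_of_nonneg (by positivity)]
    exact rpow_mul_mul_le hq (norm_nonneg _) (norm_nonneg _) (norm_nonneg _)

section
variable {E V : Type*} [NormedAddCommGroup E] [NormedSpace ℝ E] [MeasurableSpace E] [BorelSpace E]
  {μ : Measure E} [NormedAddCommGroup V] [InnerProductSpace ℝ V]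

/-- One step of the telescoping sum. The increment of `∫ ‖S‖^q` when `F` is added is of second
order in `F`, up to a term where, by integration by parts, one derivative is moved from `F` to
`S`. -/
theorem integral_norm_add_rpow_le [FiniteDimensional ℝ E] [μ.IsAddHaarMeasure] {q : ℝ}
    (hq : 2 < q) {e : E} {ρ : ℝ} (hρ : 0 < ρ) {S S' F G : E → V} (hSc : Continuous S)
    (hS'c : Continuous S') (hFc : Continuous F) (hGc : Continuous G)
    (hS' : ∀ x, HasLineDerivAt ℝ S (S' x) x e) (hG : ∀ x, HasLineDerivAt ℝ G (ρ • F x) x e)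
    (hSq : Integrable (fun x => ‖S x‖ ^ q) μ) (hS'q : Integrable (fun x => ‖S' x‖ ^ q) μ)
    (hFq : Integrable (fun x => ‖F x‖ ^ q) μ) (hGq : Integrable (fun x => ‖G x‖ ^ q) μ) :
    ∫ x, ‖S x + F x‖ ^ q ∂μ ≤ ∫ x, ‖S x‖ ^ q ∂μ +
      (q * (q - 1) * ∫ x, ‖S x‖ ^ (q - 2) * (ρ⁻¹ * ‖S' x‖ * ‖G x‖) ∂μ +
      q * (q - 1) * ∫ x, (‖S x‖ + ‖F x‖) ^ (q - 2) * ‖F x‖ ^ 2 ∂μ) := by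
  have hp : 0 < q - 2 := by linarith
  set Φ : E → V := fun x => ‖S x‖ ^ (q - 2) • S x with hΦ
  have hpowc : Continuous fun x => ‖S x‖ ^ (q - 2) := hSc.norm.rpow_const fun _ => Or.inr hp.le
  have hΦc : Continuous Φ := hpowc.smul hSc
  have hΦ' : ∀ x, HasLineDerivAt ℝ Φ (rpowSMulDeriv (q - 2) (S x) (S' x)) x e := by
    intro x
    have h1 : HasDerivAt (fun t : ℝ => S (x + t • e)) (S' x) 0 := hS' x
    have h2 : HasFDerivAt (fun z : V => ‖z‖ ^ (q - 2) • z) (rpowSMulDeriv (q - 2) (S x))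
        (S (x + (0 : ℝ) • e)) := by
      simpa using hasFDerivAt_norm_rpow_smul hp (S x)
    exact h2.comp_hasDerivAt (0 : ℝ) h1
  have hΦn : ∀ x, ‖Φ x‖ = ‖S x‖ ^ (q - 2) * ‖S x‖ := fun x => by
    rw [hΦ]; simp only
    rw [norm_smul, Real.norm_of_nonneg (by positivity)]
  have iSSF := integrable_norm_rpow_mul_mul hq hSc hSc hFc hSq hSq hFq
  have iSSG := integrable_norm_rpow_mul_mul hq hSc hSc hGc hSq hSq hGq
  have iSS'G := integrable_norm_rpow_mul_mul hq hSc hS'c hGc hSq hS'q hGq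
  have hΦ'm : AEStronglyMeasurable (fun x => inner ℝ (rpowSMulDeriv (q - 2) (S x) (S' x)) (G x))
      μ := by
    have h1 : ∀ x, inner ℝ (rpowSMulDeriv (q - 2) (S x) (S' x)) (G x) =
        ‖S x‖ ^ (q - 2) * inner ℝ (S' x) (G x) +
          (q - 2) * ‖S x‖ ^ (q - 2 - 2) * (inner ℝ (S x) (S' x) * inner ℝ (S x) (G x)) := by
      intro x
      simp [rpowSMulDeriv, inner_add_left, inner_smul_left]
    simp_rw [h1]
    have h2 : Measurable fun x => ‖S x‖ ^ (q - 2 - 2) := hSc.norm.measurable.pow_const _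
    have h3 := (hS'c.inner (𝕜 := ℝ) hGc).measurable
    have h4 := (hSc.inner (𝕜 := ℝ) hGc).measurable
    have h5 := (hSc.inner (𝕜 := ℝ) hS'c).measurable
    have h6 := hpowc.measurable
    exact Measurable.aestronglyMeasurable (by fun_prop)
  have iΦF : Integrable (fun x => inner ℝ (Φ x) (F x)) μ := by
    refine iSSF.mono' (hΦc.inner hFc).aestronglyMeasurable (Filter.Eventually.of_forall fun x => ?_)
    refine (norm_inner_le_norm _ _).trans ?_
    rw [hΦn, mul_assoc]
  have iΦG : Integrable (fun x => inner ℝ (Φ x) (G x)) μ := by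
    refine iSSG.mono' (hΦc.inner hGc).aestronglyMeasurable (Filter.Eventually.of_forall fun x => ?_)
    refine (norm_inner_le_norm _ _).trans ?_
    rw [hΦn, mul_assoc]
  have hΦ'G : ∀ x, ‖inner ℝ (rpowSMulDeriv (q - 2) (S x) (S' x)) (G x)‖ ≤
      (q - 1) * (‖S x‖ ^ (q - 2) * (‖S' x‖ * ‖G x‖)) := by
    intro x
    refine (norm_inner_le_norm _ _).trans ?_
    calc _ ≤ ((1 + (q - 2)) * ‖S x‖ ^ (q - 2) * ‖S' x‖) * ‖G x‖ := by
          gcongr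
          exact norm_rpowSMulDeriv_apply_le hp _ _
      _ = _ := by ring
  have iΦ'G : Integrable (fun x => inner ℝ (rpowSMulDeriv (q - 2) (S x) (S' x)) (G x)) μ :=
    (iSS'G.const_mul (q - 1)).mono' hΦ'm (Filter.Eventually.of_forall hΦ'G)
  have hparts : ∫ x, inner ℝ (Φ x) (ρ • F x) ∂μ =
      - ∫ x, inner ℝ (rpowSMulDeriv (q - 2) (S x) (S' x)) (G x) ∂μ := by
    have h1 : Integrable (fun x => inner ℝ (Φ x) (ρ • F x)) μ := by
      simp_rw [inner_smul_right]
      exact iΦF.const_mul ρ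
    exact integral_bilinear_hasLineDerivAt_right_eq_neg_left_of_integrable (v := e)
      (B := innerSL ℝ) iΦ'G h1 iΦG (fun x _ => hΦ' x) (fun x _ => hG x)
  have hfirst : ∫ x, inner ℝ (Φ x) (F x) ∂μ ≤
      (q - 1) * ∫ x, ‖S x‖ ^ (q - 2) * (ρ⁻¹ * ‖S' x‖ * ‖G x‖) ∂μ := by
    simp_rw [inner_smul_right] at hparts
    rw [integral_const_mul] at hparts
    have h1 : ∫ x, inner ℝ (Φ x) (F x) ∂μ =
        ρ⁻¹ * - ∫ x, inner ℝ (rpowSMulDeriv (q - 2) (S x) (S' x)) (G x) ∂μ := by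
      rw [← hparts]; field_simp
    rw [h1]
    have h2 : - ∫ x, inner ℝ (rpowSMulDeriv (q - 2) (S x) (S' x)) (G x) ∂μ ≤
        ∫ x, (q - 1) * (‖S x‖ ^ (q - 2) * (‖S' x‖ * ‖G x‖)) ∂μ := by
      refine (neg_le_abs _).trans ?_
      exact norm_integral_le_of_norm_le (iSS'G.const_mul (q - 1)) (Filter.Eventually.of_forall hΦ'G)
    refine (mul_le_mul_of_nonneg_left h2 (inv_nonneg.2 hρ.le)).trans (le_of_eq ?_)
    rw [← integral_const_mul, ← integral_const_mul]
    congr 1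
    ext x
    ring
  have hsumc : Continuous fun x => ‖S x‖ + ‖F x‖ := hSc.norm.add hFc.norm
  have hsum : Integrable (fun x => (‖S x‖ + ‖F x‖) ^ q) μ := by
    refine ((hSq.add hFq).const_mul (2 ^ q)).mono'
      (hsumc.rpow_const fun _ => Or.inr (by linarith)).aestronglyMeasurable
      (Filter.Eventually.of_forall fun x => ?_)
    rw [Real.norm_of_nonneg (by positivity)]
    exact add_rpow_le_two_rpow_mul (by linarith) (norm_nonneg _) (norm_nonneg _)
  have iR : Integrable (fun x => (‖S x‖ + ‖F x‖) ^ (q - 2) * ‖F x‖ ^ 2) μ := by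
    have h1 := integrable_norm_rpow_mul_mul (V := ℝ) (μ := μ) hq hsumc hFc.norm hFc.norm
      (by convert hsum using 3 with x; exact Real.norm_of_nonneg (by positivity))
      (by simpa using hFq) (by simpa using hFq)
    convert h1 using 3 with x
    · rw [Real.norm_of_nonneg (by positivity)]
    · rw [norm_norm, sq]
  have iSF : Integrable (fun x => ‖S x + F x‖ ^ q) μ := by
    refine hsum.mono' ((hSc.add hFc).norm.rpow_const fun _ =>
      Or.inr (by linarith)).aestronglyMeasurable (Filter.Eventually.of_forall fun x => ?_)
    rw [Real.norm_of_nonneg (by positivity)]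
    have := norm_add_le (S x) (F x)
    gcongr
  calc ∫ x, ‖S x + F x‖ ^ q ∂μ
      ≤ ∫ x, (‖S x‖ ^ q + q * inner ℝ (Φ x) (F x) +
          q * (q - 1) * ((‖S x‖ + ‖F x‖) ^ (q - 2) * ‖F x‖ ^ 2)) ∂μ := by
        refine integral_mono iSF ((hSq.add (iΦF.const_mul q)).add (iR.const_mul _)) fun x => ?_
        exact norm_add_rpow_le hq _ _
    _ = ∫ x, ‖S x‖ ^ q ∂μ + q * ∫ x, inner ℝ (Φ x) (F x) ∂μ +
          q * (q - 1) * ∫ x, (‖S x‖ + ‖F x‖) ^ (q - 2) * ‖F x‖ ^ 2 ∂μ := by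
        rw [integral_add (f := fun x => ‖S x‖ ^ q + q * inner ℝ (Φ x) (F x))
          (hSq.add (iΦF.const_mul q)) (iR.const_mul _),
          integral_add hSq (iΦF.const_mul q), integral_const_mul, integral_const_mul]
    _ ≤ _ := by
        have := mul_le_mul_of_nonneg_left hfirst (by linarith : 0 ≤ q)
        linarith

end

/-! ### The reverse square function inequality for lacunary frequencies -/

theorem ofReal_integral_le_lintegral {α : Type*} [MeasurableSpace α] {μ : Measure α} {f : α → ℝ}
    (hf : 0 ≤ f) : ENNReal.ofReal (∫ x, f x ∂μ) ≤ ∫⁻ x, ENNReal.ofReal (f x) ∂μ := by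
  by_cases h : Integrable f μ
  · exact (ofReal_integral_eq_lintegral_ofReal h (Filter.Eventually.of_forall hf)).le
  · simp [integral_undef h]

theorem enn_add_sq_le (x y : ℝ≥0∞) : (x + y) ^ 2 ≤ 2 * (x ^ 2 + y ^ 2) := by
  have := ENNReal.rpow_add_le_mul_rpow_add_rpow x y (p := 2) (by norm_num)
  norm_num at this
  exact this

theorem enn_mul_le_sq_add_sq (x y : ℝ≥0∞) : x * y ≤ x ^ 2 + y ^ 2 := by
  rcases le_total x y with h | h
  · calc x * y ≤ y * y := by gcongr
      _ = y ^ 2 := (sq y).symm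
      _ ≤ _ := le_add_self
  · calc x * y ≤ x * x := by gcongr
      _ = x ^ 2 := (sq x).symm
      _ ≤ _ := le_self_add

/-- The discrete Hardy inequality behind the lacunarity: a sequence that halves at each step,
with `u` as input, is controlled by `u` in `ℓ²`. -/
theorem sum_sq_le_of_halving {b u : ℕ → ℝ≥0∞} (h0 : b 0 = 0)
    (h : ∀ n, 2 * b (n + 1) ≤ b n + u n) (M : ℕ) :
    ∑ n ∈ Finset.range M, b n ^ 2 ≤ ∑ n ∈ Finset.range M, u n ^ 2 := by
  have key : ∑ n ∈ Finset.range M, b n ^ 2 + 2 * b M ^ 2 ≤ ∑ n ∈ Finset.range M, u n ^ 2 := by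
    induction M with
    | zero => simp [h0]
    | succ M ih =>
      rw [Finset.sum_range_succ, Finset.sum_range_succ]
      have h1 : 2 * (2 * b (M + 1) ^ 2) ≤ 2 * (b M ^ 2 + u M ^ 2) := by
        calc 2 * (2 * b (M + 1) ^ 2) = (2 * b (M + 1)) ^ 2 := by ring
          _ ≤ (b M + u M) ^ 2 := by gcongr; exact h M
          _ ≤ _ := enn_add_sq_le _ _
      have h2 : 2 * b (M + 1) ^ 2 ≤ b M ^ 2 + u M ^ 2 :=
        (ENNReal.mul_le_mul_iff_right (by norm_num) (by norm_num)).1 h1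
      calc _ ≤ ∑ n ∈ Finset.range M, b n ^ 2 + b M ^ 2 + (b M ^ 2 + u M ^ 2) := by gcongr
        _ = (∑ n ∈ Finset.range M, b n ^ 2 + 2 * b M ^ 2) + u M ^ 2 := by ring
        _ ≤ _ := by gcongr
  exact le_self_add.trans key

/-- Multipliers adapted to the annulus `κ⁻¹ ≤ |ξ| ≤ κ`: a cutoff, differentiation, and its
inverse. -/
theorem exists_multipliers {κ : ℝ} (hκ : 1 ≤ κ) : ∃ φ₀ φG φH : ℝ → ℂ,
    (ContDiff ℝ ∞ φ₀ ∧ HasCompactSupport φ₀) ∧ (ContDiff ℝ ∞ φG ∧ HasCompactSupport φG) ∧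
    (ContDiff ℝ ∞ φH ∧ HasCompactSupport φH) ∧
    (∀ ξ, |ξ| ≤ κ → φ₀ ξ = 1) ∧ (∀ ξ, 2 * κ ≤ |ξ| → φ₀ ξ = 0) ∧
    (∀ ξ : ℝ, κ⁻¹ ≤ |ξ| → |ξ| ≤ κ → Complex.I * (ξ : ℂ) * φG ξ = 1) ∧
    (∀ ξ : ℝ, |ξ| ≤ κ → φH ξ = Complex.I * (ξ : ℂ)) := by
  have hκ0 : 0 < κ := by linarith
  let B : ContDiffBump (0 : ℝ) := ⟨κ, 2 * κ, hκ0, by linarith⟩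
  let D : ContDiffBump (0 : ℝ) := ⟨κ⁻¹ / 2, κ⁻¹, by positivity, by
    have : 0 < κ⁻¹ := by positivity
    linarith⟩
  have hofReal : ContDiff ℝ ∞ (fun x : ℝ => (x : ℂ)) := Complex.ofRealCLM.contDiff
  have hBs : ContDiff ℝ ∞ fun ξ => (B ξ : ℂ) := hofReal.comp B.contDiff
  have hBc : HasCompactSupport fun ξ => (B ξ : ℂ) :=
    B.hasCompactSupport.comp_left (g := fun x : ℝ => (x : ℂ)) (by simp)
  have hB1 : ∀ ξ : ℝ, |ξ| ≤ κ → B ξ = 1 := fun ξ h =>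
    B.one_of_mem_closedBall (by simpa using h)
  have hB0 : ∀ ξ : ℝ, 2 * κ ≤ |ξ| → B ξ = 0 := fun ξ h =>
    B.zero_of_le_dist (by simpa using h)
  have hD0 : ∀ ξ : ℝ, κ⁻¹ ≤ |ξ| → D ξ = 0 := fun ξ h =>
    D.zero_of_le_dist (by simpa using h)
  -- The bump `D` keeps the denominator away from zero near the origin.
  have hpos : ∀ ξ : ℝ, 0 < ξ ^ 2 + D ξ := by
    intro ξ
    by_cases h : ξ = 0
    · have : D ξ = 1 := D.one_of_mem_closedBall (by simp [h, D]; positivity)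
      rw [this]; positivity
    · have := D.nonneg' ξ
      positivity
  have hquot : ContDiff ℝ ∞ fun ξ : ℝ => ((ξ / (ξ ^ 2 + D ξ) : ℝ) : ℂ) := by
    refine hofReal.comp ?_
    exact contDiff_id.div ((contDiff_id.pow 2).add D.contDiff) fun ξ => (hpos ξ).ne'
  refine ⟨fun ξ => (B ξ : ℂ), fun ξ => (-Complex.I * ((ξ / (ξ ^ 2 + D ξ) : ℝ) : ℂ)) * (B ξ : ℂ),
    fun ξ => (Complex.I * (ξ : ℂ)) * (B ξ : ℂ), ⟨hBs, hBc⟩,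
    ⟨(contDiff_const.mul hquot).mul hBs, hBc.mul_left⟩,
    ⟨(contDiff_const.mul hofReal).mul hBs, hBc.mul_left⟩, ?_, ?_, ?_, ?_⟩
  · intro ξ h; simp [hB1 ξ h]
  · intro ξ h; simp [hB0 ξ h]
  · intro ξ h1 h2
    have hξ : ξ ≠ 0 := by
      rintro rfl
      have : 0 < κ⁻¹ := by positivity
      simp at h1
      linarith
    simp only [hB1 ξ h2, hD0 ξ h1, add_zero]
    have : ξ / ξ ^ 2 = ξ⁻¹ := by field_simp
    rw [this]
    have hξ' : (ξ : ℂ) ≠ 0 := by exact_mod_cast hξ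
    push_cast
    field_simp
    simp
  · intro ξ h; simp [hB1 ξ h]

/-- A smooth compactly supported multiplier in a direction is dominated by averages along that
direction, with a constant that depends only on the multiplier. -/
theorem exists_enorm_oscInt_mul_le {φ : ℝ → ℂ} (hφ : ContDiff ℝ ∞ φ) (hφc : HasCompactSupport φ) :
    ∃ A : ℝ, 0 ≤ A ∧ ∀ (d : ℕ) [NeZero d] (Γ : ℝ → EuclideanSpace ℝ (Fin d)), Continuous Γ →
      ∀ h : ℝ → ℂ, Integrable h → ∀ (r : ℝ) (x : EuclideanSpace ℝ (Fin d)),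
      ‖oscInt Γ (fun t => φ (r * inner ℝ (firstAxis d) (Γ t)) * h t) x‖ₑ ≤
        ENNReal.ofReal A * lineAvg (firstAxis d) r (fun y => ‖oscInt Γ h y‖ₑ) x := by
  obtain ⟨k, hk, A, hA, hkA, hkφ⟩ := exists_kernel hφ hφc
  exact ⟨A, hA, fun d _ Γ hΓ h hh r x => enorm_oscInt_mul_le hk hkA hkφ hΓ hh r x⟩

theorem integrable_multiplier_mul {φ : ℝ → ℂ} (hφ : ContDiff ℝ ∞ φ) (hφc : HasCompactSupport φ)
    {a : ℝ → ℝ} (ha : Continuous a) {h : ℝ → ℂ} (hh : Integrable h) :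
    Integrable fun t => φ (a t) * h t := by
  obtain ⟨C, hC⟩ := hφ.continuous.bounded_above_of_compact_support hφc
  exact hh.bdd_mul (c := C) (hφ.continuous.comp ha).aestronglyMeasurable
    (Filter.Eventually.of_forall fun t => hC _)

theorem integrable_norm_rpow_of_lintegral_lt_top {E : Type*} [TopologicalSpace E]
    [MeasurableSpace E] [BorelSpace E] {μ : Measure E} {q : ℝ} (hq : 0 < q) {f : E → ℂ}
    (hf : Continuous f) (h : ∫⁻ x, ‖f x‖ₑ ^ q ∂μ < ⊤) : Integrable (fun x => ‖f x‖ ^ q) μ := by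
  refine ⟨(hf.norm.rpow_const fun _ => Or.inr hq.le).aestronglyMeasurable, ?_⟩
  rw [hasFiniteIntegral_iff_enorm]
  convert h using 3 with x
  rw [← ofReal_norm, ← ofReal_norm, Real.norm_of_nonneg (by positivity),
    ENNReal.ofReal_rpow_of_nonneg (norm_nonneg _) hq.le]

theorem lintegral_enorm_rpow_eq {E : Type*} [TopologicalSpace E]
    [MeasurableSpace E] [BorelSpace E] {μ : Measure E} {q : ℝ} (hq : 0 < q) {f : E → ℂ}
    (hf : Integrable (fun x => ‖f x‖ ^ q) μ) :
    ∫⁻ x, ‖f x‖ₑ ^ q ∂μ = ENNReal.ofReal (∫ x, ‖f x‖ ^ q ∂μ) := by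
  rw [ofReal_integral_eq_lintegral_ofReal hf (Filter.Eventually.of_forall fun x => by positivity)]
  refine lintegral_congr fun x => ?_
  rw [← ofReal_norm, ENNReal.ofReal_rpow_of_nonneg (norm_nonneg _) hq.le]

/-- The step inequality `integral_norm_add_rpow_le` in terms of integrals with values in
`[0, ∞]`. -/
theorem lintegral_enorm_add_rpow_le {E : Type*} [NormedAddCommGroup E] [NormedSpace ℝ E]
    [MeasurableSpace E] [BorelSpace E] {μ : Measure E} [FiniteDimensional ℝ E]
    [μ.IsAddHaarMeasure] {q : ℝ}
    (hq : 2 < q) {e : E} {ρ : ℝ} (hρ : 0 < ρ) {S S' F G : E → ℂ} (hSc : Continuous S)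
    (hS'c : Continuous S') (hFc : Continuous F) (hGc : Continuous G)
    (hS' : ∀ x, HasLineDerivAt ℝ S (S' x) x e) (hG : ∀ x, HasLineDerivAt ℝ G (ρ • F x) x e)
    (hSq : ∫⁻ x, ‖S x‖ₑ ^ q ∂μ < ⊤) (hS'q : ∫⁻ x, ‖S' x‖ₑ ^ q ∂μ < ⊤)
    (hFq : ∫⁻ x, ‖F x‖ₑ ^ q ∂μ < ⊤) (hGq : ∫⁻ x, ‖G x‖ₑ ^ q ∂μ < ⊤)
    (hSFq : ∫⁻ x, ‖S x + F x‖ₑ ^ q ∂μ < ⊤) :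
    ∫⁻ x, ‖S x + F x‖ₑ ^ q ∂μ ≤ ∫⁻ x, ‖S x‖ₑ ^ q ∂μ +
      ENNReal.ofReal (q * (q - 1)) *
        ∫⁻ x, (‖S x‖ₑ ^ (q - 2) * (ENNReal.ofReal ρ⁻¹ * ‖S' x‖ₑ * ‖G x‖ₑ) +
          (‖S x‖ₑ + ‖F x‖ₑ) ^ (q - 2) * ‖F x‖ₑ ^ 2) ∂μ := by
  have hq0 : 0 < q := by linarith
  have hp : 0 ≤ q - 2 := by linarith
  have hc : 0 ≤ q * (q - 1) := by nlinarith
  have iS := integrable_norm_rpow_of_lintegral_lt_top hq0 hSc hSq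
  have iF := integrable_norm_rpow_of_lintegral_lt_top hq0 hFc hFq
  have iSF := integrable_norm_rpow_of_lintegral_lt_top hq0 (f := fun x => S x + F x)
    (hSc.add hFc) hSFq
  have key := integral_norm_add_rpow_le hq hρ hSc hS'c hFc hGc hS' hG iS
    (integrable_norm_rpow_of_lintegral_lt_top hq0 hS'c hS'q) iF
    (integrable_norm_rpow_of_lintegral_lt_top hq0 hGc hGq)
  have h1 : ∀ x, ENNReal.ofReal (‖S x‖ ^ (q - 2) * (ρ⁻¹ * ‖S' x‖ * ‖G x‖)) =
      ‖S x‖ₑ ^ (q - 2) * (ENNReal.ofReal ρ⁻¹ * ‖S' x‖ₑ * ‖G x‖ₑ) := by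
    intro x
    have : 0 ≤ ρ⁻¹ := by positivity
    rw [ENNReal.ofReal_mul (by positivity), ENNReal.ofReal_mul (by positivity),
      ENNReal.ofReal_mul (by positivity), ofReal_norm, ofReal_norm,
      ← ENNReal.ofReal_rpow_of_nonneg (norm_nonneg _) hp, ofReal_norm]
  have h2 : ∀ x, ENNReal.ofReal ((‖S x‖ + ‖F x‖) ^ (q - 2) * ‖F x‖ ^ 2) =
      (‖S x‖ₑ + ‖F x‖ₑ) ^ (q - 2) * ‖F x‖ₑ ^ 2 := by
    intro x
    rw [ENNReal.ofReal_mul (by positivity), ENNReal.ofReal_pow (norm_nonneg _), ofReal_norm,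
      ← ENNReal.ofReal_rpow_of_nonneg (by positivity) hp,
      ENNReal.ofReal_add (norm_nonneg _) (norm_nonneg _), ofReal_norm, ofReal_norm]
  have hm : Measurable fun x => ‖S x‖ₑ ^ (q - 2) * (ENNReal.ofReal ρ⁻¹ * ‖S' x‖ₑ * ‖G x‖ₑ) := by
    have h3 := hSc.enorm.measurable
    have h4 := hS'c.enorm.measurable
    have h5 := hGc.enorm.measurable
    fun_prop
  rw [lintegral_enorm_rpow_eq hq0 iSF, lintegral_enorm_rpow_eq hq0 iS, lintegral_add_left hm,
    mul_add]
  refine (ENNReal.ofReal_le_ofReal key).trans ?_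
  refine ENNReal.ofReal_add_le.trans ?_
  gcongr
  refine ENNReal.ofReal_add_le.trans ?_
  rw [ENNReal.ofReal_mul hc, ENNReal.ofReal_mul hc]
  simp_rw [← h1, ← h2]
  gcongr
  · refine ofReal_integral_le_lintegral fun x => ?_
    have : 0 ≤ ρ⁻¹ := by positivity
    show 0 ≤ _
    positivity
  · exact ofReal_integral_le_lintegral fun x => by show 0 ≤ _; positivity

theorem lintegral_enorm_sum_rpow_lt_top {E : Type*} [TopologicalSpace E]
    [MeasurableSpace E] [BorelSpace E] {μ : Measure E} {q : ℝ} (hq : 0 < q) {ι : Type*}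
    (s : Finset ι) {f : ι → E → ℂ} (hf : ∀ i ∈ s, Continuous (f i))
    (h : ∀ i ∈ s, ∫⁻ x, ‖f i x‖ₑ ^ q ∂μ < ⊤) : ∫⁻ x, ‖∑ i ∈ s, f i x‖ₑ ^ q ∂μ < ⊤ := by
  have hq0 : ENNReal.ofReal q ≠ 0 := by simpa using hq
  have key : ∀ g : E → ℂ, eLpNorm g (ENNReal.ofReal q) μ < ⊤ ↔ ∫⁻ x, ‖g x‖ₑ ^ q ∂μ < ⊤ := by
    intro g
    rw [eLpNorm_lt_top_iff_lintegral_rpow_enorm_lt_top hq0 ENNReal.ofReal_ne_top,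
      ENNReal.toReal_ofReal hq.le]
  have : MemLp (fun x => ∑ i ∈ s, f i x) (ENNReal.ofReal q) μ :=
    memLp_finsetSum s fun i hi => ⟨(hf i hi).aestronglyMeasurable, (key _).2 (h i hi)⟩
  exact (key _).1 this.2

/-- The telescoping estimate for a lacunary sum. Here `G n` and `H n` are `F n` with one derivative
in direction `e` removed, respectively added, at the scale `ρ n`, and `W` dominates all partial
sums. -/
theorem lintegral_sum_rpow_le_of_lacunary {E : Type*} [NormedAddCommGroup E] [NormedSpace ℝ E]
    [MeasurableSpace E] [BorelSpace E] {μ : Measure E} [FiniteDimensional ℝ E]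
    [μ.IsAddHaarMeasure] {q : ℝ} (hq : 2 < q) {e : E} {ρ : ℕ → ℝ} (hρ : ∀ n, 0 < ρ n)
    (hlac : ∀ n, 2 * ρ n ≤ ρ (n + 1)) {F G H : ℕ → E → ℂ} (hFc : ∀ n, Continuous (F n))
    (hGc : ∀ n, Continuous (G n)) (hHc : ∀ n, Continuous (H n))
    (hF : ∀ n x, HasLineDerivAt ℝ (F n) (ρ n • H n x) x e)
    (hG : ∀ n x, HasLineDerivAt ℝ (G n) (ρ n • F n x) x e)
    (hFq : ∀ n, ∫⁻ x, ‖F n x‖ₑ ^ q ∂μ < ⊤) (hGq : ∀ n, ∫⁻ x, ‖G n x‖ₑ ^ q ∂μ < ⊤)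
    (hHq : ∀ n, ∫⁻ x, ‖H n x‖ₑ ^ q ∂μ < ⊤) (M : ℕ) {W : E → ℝ≥0∞}
    (hW : ∀ n ≤ M, ∀ x, ‖∑ j ∈ Finset.range n, F j x‖ₑ ≤ W x) :
    ∫⁻ x, ‖∑ j ∈ Finset.range M, F j x‖ₑ ^ q ∂μ ≤ ENNReal.ofReal (q * (q - 1)) * 3 ^ (q - 2) *
      ∫⁻ x, W x ^ (q - 2) *
        ∑ n ∈ Finset.range M, (‖F n x‖ₑ ^ 2 + ‖G n x‖ₑ ^ 2 + ‖H n x‖ₑ ^ 2) ∂μ := by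
  have hq0 : 0 < q := by linarith
  have hp : 0 ≤ q - 2 := by linarith
  set S : ℕ → E → ℂ := fun n x => ∑ j ∈ Finset.range n, F j x with hS
  set S' : ℕ → E → ℂ := fun n x => ∑ j ∈ Finset.range n, ρ j • H j x with hS'
  have hSc : ∀ n, Continuous (S n) := fun n => continuous_finsetSum _ fun j _ => hFc j
  have hρHc : ∀ j, Continuous fun x => ρ j • H j x := fun j => by
    have := hHc j
    fun_prop
  have hS'c : ∀ n, Continuous (S' n) := fun n => continuous_finsetSum _ fun j _ => hρHc j
  have hSder : ∀ n x, HasLineDerivAt ℝ (S n) (S' n x) x e := by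
    intro n x
    have : HasDerivAt (fun t : ℝ => ∑ j ∈ Finset.range n, F j (x + t • e))
        (∑ j ∈ Finset.range n, ρ j • H j x) 0 := HasDerivAt.fun_sum fun j _ => hF j x
    exact this
  have hSq : ∀ n, ∫⁻ x, ‖S n x‖ₑ ^ q ∂μ < ⊤ := fun n =>
    lintegral_enorm_sum_rpow_lt_top hq0 _ (fun j _ => hFc j) (fun j _ => hFq j)
  have hS'q : ∀ n, ∫⁻ x, ‖S' n x‖ₑ ^ q ∂μ < ⊤ := by
    refine fun n => lintegral_enorm_sum_rpow_lt_top hq0 _ (fun j _ => hρHc j)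
      (fun j _ => ?_)
    simp_rw [enorm_smul, ENNReal.mul_rpow_of_nonneg _ _ hq0.le]
    rw [lintegral_const_mul' _ _ (ENNReal.rpow_ne_top_of_nonneg hq0.le enorm_ne_top)]
    exact ENNReal.mul_lt_top (ENNReal.rpow_lt_top_of_nonneg hq0.le enorm_ne_top) (hHq j)
  set T : ℕ → E → ℝ≥0∞ := fun n x =>
    ‖S n x‖ₑ ^ (q - 2) * (ENNReal.ofReal (ρ n)⁻¹ * ‖S' n x‖ₑ * ‖G n x‖ₑ) +
      (‖S n x‖ₑ + ‖F n x‖ₑ) ^ (q - 2) * ‖F n x‖ₑ ^ 2 with hT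
  have hstep : ∀ n, ∫⁻ x, ‖S (n + 1) x‖ₑ ^ q ∂μ ≤
      ∫⁻ x, ‖S n x‖ₑ ^ q ∂μ + ENNReal.ofReal (q * (q - 1)) * ∫⁻ x, T n x ∂μ := by
    intro n
    have hsucc : ∀ x, S (n + 1) x = S n x + F n x := fun x => Finset.sum_range_succ _ _
    have h1 := hSq (n + 1)
    simp_rw [hsucc] at h1 ⊢
    exact lintegral_enorm_add_rpow_le hq (hρ n) (hSc n) (hS'c n) (hFc n) (hGc n) (hSder n) (hG n)
      (hSq n) (hS'q n) (hFq n) (hGq n) h1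
  have htel : ∀ n, ∫⁻ x, ‖S n x‖ₑ ^ q ∂μ ≤
      ENNReal.ofReal (q * (q - 1)) * ∑ j ∈ Finset.range n, ∫⁻ x, T j x ∂μ := by
    intro n
    induction n with
    | zero => simp [hS, hq0]
    | succ n ih =>
      rw [Finset.sum_range_succ, mul_add]
      exact (hstep n).trans (add_le_add_left ih _)
  have hTm : ∀ n, Measurable (T n) := by
    intro n
    have h1 := (hSc n).enorm.measurable
    have h2 := (hS'c n).enorm.measurable
    have h3 := (hGc n).enorm.measurable
    have h4 := (hFc n).enorm.measurable
    fun_prop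
  refine (htel M).trans ?_
  rw [← lintegral_finsetSum _ (fun n _ => hTm n), mul_assoc]
  refine mul_le_mul_right ?_ _
  rw [← lintegral_const_mul' _ _ (ENNReal.rpow_ne_top_of_nonneg hp (by norm_num))]
  refine lintegral_mono fun x => ?_
  set b : ℕ → ℝ≥0∞ := fun n => ENNReal.ofReal (ρ n)⁻¹ * ‖S' n x‖ₑ with hb
  -- Lacunarity enters here: passing to the next frequency halves the weight of the
  -- derivatives of all earlier terms.
  have hhalf : ∀ n, 2 * b (n + 1) ≤ b n + ‖H n x‖ₑ := by
    intro n
    have h1 : S' (n + 1) x = S' n x + ρ n • H n x := Finset.sum_range_succ _ _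
    have h2 : 2 * (ρ (n + 1))⁻¹ ≤ (ρ n)⁻¹ := by
      rw [← div_eq_mul_inv, div_le_iff₀ (hρ _), ← div_eq_inv_mul, le_div_iff₀ (hρ n)]
      exact hlac n
    have h3 : 2 * ENNReal.ofReal (ρ (n + 1))⁻¹ ≤ ENNReal.ofReal (ρ n)⁻¹ := by
      rw [show (2 : ℝ≥0∞) = ENNReal.ofReal 2 by norm_num, ← ENNReal.ofReal_mul (by norm_num)]
      exact ENNReal.ofReal_le_ofReal h2
    calc 2 * b (n + 1) = (2 * ENNReal.ofReal (ρ (n + 1))⁻¹) * ‖S' (n + 1) x‖ₑ := by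
          rw [hb, mul_assoc]
      _ ≤ ENNReal.ofReal (ρ n)⁻¹ * (‖S' n x‖ₑ + ‖ρ n • H n x‖ₑ) := by
          gcongr
          rw [h1]
          exact enorm_add_le _ _
      _ = b n + (ENNReal.ofReal (ρ n)⁻¹ * ENNReal.ofReal (ρ n)) * ‖H n x‖ₑ := by
          rw [mul_add, enorm_smul, Real.enorm_of_nonneg (hρ n).le, mul_assoc]
      _ = _ := by
          rw [← ENNReal.ofReal_mul (inv_nonneg.2 (hρ n).le), inv_mul_cancel₀ (hρ n).ne']
          simp
  have hsq := sum_sq_le_of_halving (b := b) (u := fun n => ‖H n x‖ₑ) (by simp [hb, hS']) hhalf M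
  have hone : (1 : ℝ≥0∞) ≤ 3 ^ (q - 2) := ENNReal.one_le_rpow (by norm_num) (by
    rcases hp.eq_or_lt with h | h
    · linarith
    · exact h)
  have hTle : ∀ n ∈ Finset.range M, T n x ≤ 3 ^ (q - 2) * W x ^ (q - 2) *
      (‖F n x‖ₑ ^ 2 + ‖G n x‖ₑ ^ 2 + b n ^ 2) := by
    intro n hn
    have hn' : n < M := Finset.mem_range.1 hn
    have hSW : ‖S n x‖ₑ ≤ W x := hW n hn'.le x
    have hFW : ‖F n x‖ₑ ≤ 2 * W x := by
      have : F n x = S (n + 1) x - S n x := by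
        simp [hS, Finset.sum_range_succ]
      rw [this, two_mul]
      exact (enorm_sub_le).trans (add_le_add (hW _ hn' x) hSW)
    have h1 : ‖S n x‖ₑ ^ (q - 2) * (ENNReal.ofReal (ρ n)⁻¹ * ‖S' n x‖ₑ * ‖G n x‖ₑ) ≤
        3 ^ (q - 2) * W x ^ (q - 2) * (‖G n x‖ₑ ^ 2 + b n ^ 2) := by
      refine mul_le_mul' ?_ ?_
      · calc ‖S n x‖ₑ ^ (q - 2) ≤ 1 * W x ^ (q - 2) := by rw [one_mul]; gcongr
          _ ≤ _ := by gcongr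
      · rw [add_comm]; exact enn_mul_le_sq_add_sq _ _
    have h2 : (‖S n x‖ₑ + ‖F n x‖ₑ) ^ (q - 2) ≤ 3 ^ (q - 2) * W x ^ (q - 2) := by
      rw [← ENNReal.mul_rpow_of_nonneg _ _ hp]
      gcongr
      calc _ ≤ W x + 2 * W x := add_le_add hSW hFW
        _ = 3 * W x := by ring
    calc T n x ≤ 3 ^ (q - 2) * W x ^ (q - 2) * (‖G n x‖ₑ ^ 2 + b n ^ 2) +
          3 ^ (q - 2) * W x ^ (q - 2) * ‖F n x‖ₑ ^ 2 := add_le_add h1 (mul_le_mul_left h2 _)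
      _ = _ := by ring
  calc ∑ n ∈ Finset.range M, T n x
      ≤ ∑ n ∈ Finset.range M, 3 ^ (q - 2) * W x ^ (q - 2) *
          (‖F n x‖ₑ ^ 2 + ‖G n x‖ₑ ^ 2 + b n ^ 2) := Finset.sum_le_sum hTle
    _ = 3 ^ (q - 2) * W x ^ (q - 2) * (∑ n ∈ Finset.range M, (‖F n x‖ₑ ^ 2 + ‖G n x‖ₑ ^ 2) +
          ∑ n ∈ Finset.range M, b n ^ 2) := by
        rw [← Finset.mul_sum, Finset.sum_add_distrib]
    _ ≤ 3 ^ (q - 2) * W x ^ (q - 2) * (∑ n ∈ Finset.range M, (‖F n x‖ₑ ^ 2 + ‖G n x‖ₑ ^ 2) +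
          ∑ n ∈ Finset.range M, ‖H n x‖ₑ ^ 2) := by gcongr
    _ = _ := by rw [← Finset.sum_add_distrib, mul_assoc]

/-- The reverse square function inequality, `q > 2`, for oscillatory integrals whose frequencies in
the first direction lie in lacunary annuli. -/
theorem lintegral_sum_oscInt_rpow_le {q κ : ℝ} (hq : 2 < q) (hκ : 1 ≤ κ) : ∃ C : ℝ≥0,
    ∀ (d : ℕ) [NeZero d] (Γ : ℝ → EuclideanSpace ℝ (Fin d)), Continuous Γ →
      ∀ ρ : ℕ → ℝ, (∀ n, 0 < ρ n) → (∀ n, 2 * κ ^ 2 * ρ n ≤ ρ (n + 1)) →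
      ∀ h : ℕ → ℝ → ℂ, (∀ n, Integrable (h n)) →
      (∀ n t, h n t ≠ 0 → κ⁻¹ * ρ n ≤ |inner ℝ (firstAxis d) (Γ t)| ∧
        |inner ℝ (firstAxis d) (Γ t)| ≤ κ * ρ n) →
      (∀ n, ∫⁻ x, ‖oscInt Γ (h n) x‖ₑ ^ q < ⊤) → ∀ M : ℕ,
      ∫⁻ x, ‖∑ n ∈ Finset.range M, oscInt Γ (h n) x‖ₑ ^ q ≤
        C * ∫⁻ x, (∑ n ∈ Finset.range M, ‖oscInt Γ (h n) x‖ₑ ^ 2) ^ (q / 2) := by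
  have hq0 : 0 < q := by linarith
  have hp : 0 < q - 2 := by linarith
  have hκ0 : 0 < κ := by linarith
  obtain ⟨φ₀, φG, φH, ⟨hφ₀, hφ₀c⟩, ⟨hφG, hφGc⟩, ⟨hφH, hφHc⟩, h₀one, h₀zero, hGI, hHI⟩ :=
    exists_multipliers hκ
  obtain ⟨A₀, hA₀, hbd₀⟩ := exists_enorm_oscInt_mul_le hφ₀ hφ₀c
  obtain ⟨AG, hAG, hbdG⟩ := exists_enorm_oscInt_mul_le hφG hφGc
  obtain ⟨AH, hAH, hbdH⟩ := exists_enorm_oscInt_mul_le hφH hφHc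
  obtain ⟨C₁, hC₁, hmax₁⟩ := lintegral_lineMax_rpow_le (p := q) (by linarith)
  have hqp : 1 < q / (q - 2) := by rw [lt_div_iff₀ hp]; linarith
  obtain ⟨C₂, hC₂, hmax₂⟩ := lintegral_lineMax_rpow_le hqp
  -- With `X = ∫ ‖∑ F n‖ ^ q`, the constants serve in `∫ W ^ q ≤ K₁ * X`, in
  -- `∫ Z ^ (q / (q - 2)) ≤ C₂ * K₁ * X` and in `X ≤ D * Y ^ (2 / q) * X ^ θ`.
  set K₁ : ℝ≥0∞ := ENNReal.ofReal A₀ ^ q * ENNReal.ofReal C₁ with hK₁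
  set B : ℝ≥0∞ := (ENNReal.ofReal AG ^ 2 + ENNReal.ofReal AH ^ 2) * ENNReal.ofReal Real.pi with hB
  set c : ℝ≥0∞ := ENNReal.ofReal (q * (q - 1)) * 3 ^ (q - 2) with hc
  set θ : ℝ := (q - 2) / q with hθ
  set D : ℝ≥0∞ := c * (K₁ ^ θ + B * (ENNReal.ofReal C₂ * K₁) ^ θ) with hD
  have hθ0 : 0 < θ := div_pos hp hq0
  have hDtop : D ≠ ⊤ := by
    have h1 : K₁ ≠ ⊤ := ENNReal.mul_ne_top
      (ENNReal.rpow_ne_top_of_nonneg hq0.le ENNReal.ofReal_ne_top) ENNReal.ofReal_ne_top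
    have h2 : B ≠ ⊤ := ENNReal.mul_ne_top (ENNReal.add_ne_top.2
      ⟨ENNReal.pow_ne_top ENNReal.ofReal_ne_top, ENNReal.pow_ne_top ENNReal.ofReal_ne_top⟩)
      ENNReal.ofReal_ne_top
    have h3 : c ≠ ⊤ := ENNReal.mul_ne_top ENNReal.ofReal_ne_top
      (ENNReal.rpow_ne_top_of_nonneg hp.le (by norm_num))
    exact ENNReal.mul_ne_top h3 (ENNReal.add_ne_top.2
      ⟨ENNReal.rpow_ne_top_of_nonneg hθ0.le h1, ENNReal.mul_ne_top h2
        (ENNReal.rpow_ne_top_of_nonneg hθ0.le (ENNReal.mul_ne_top ENNReal.ofReal_ne_top h1))⟩)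
  refine ⟨(D ^ (q / 2)).toNNReal, fun d _ Γ hΓ ρ hρ hlac h hh hsupp hFq M => ?_⟩
  rw [ENNReal.coe_toNNReal (ENNReal.rpow_ne_top_of_nonneg (by positivity) hDtop)]
  set e := firstAxis d with he
  set a : ℝ → ℝ := fun t => inner ℝ e (Γ t) with ha
  have hac : Continuous a := by fun_prop
  set r : ℕ → ℝ := fun n => (ρ n)⁻¹ with hr
  have hr0 : ∀ n, 0 < r n := fun n => inv_pos.2 (hρ n)
  have hlac2 : ∀ n, 2 * ρ n ≤ ρ (n + 1) := fun n => by
    refine le_trans ?_ (hlac n)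
    have h1 : 1 ≤ κ ^ 2 := one_le_pow₀ hκ
    have h2 := hρ n
    gcongr
    linarith
  have hmono : Monotone ρ := monotone_nat_of_le_succ fun n => by
    linarith [hlac2 n, hρ n]
  set F : ℕ → EuclideanSpace ℝ (Fin d) → ℂ := fun n => oscInt Γ (h n) with hF
  set gG : ℕ → ℝ → ℂ := fun n t => φG (r n * a t) * h n t with hgG
  set gH : ℕ → ℝ → ℂ := fun n t => φH (r n * a t) * h n t with hgH
  have hgGi : ∀ n, Integrable (gG n) := fun n =>
    integrable_multiplier_mul hφG hφGc (by fun_prop) (hh n)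
  have hgHi : ∀ n, Integrable (gH n) := fun n =>
    integrable_multiplier_mul hφH hφHc (by fun_prop) (hh n)
  set G : ℕ → EuclideanSpace ℝ (Fin d) → ℂ := fun n => oscInt Γ (gG n) with hG
  set H : ℕ → EuclideanSpace ℝ (Fin d) → ℂ := fun n => oscInt Γ (gH n) with hH
  have hFc : ∀ n, Continuous (F n) := fun n => continuous_oscInt hΓ (hh n)
  have hGc : ∀ n, Continuous (G n) := fun n => continuous_oscInt hΓ (hgGi n)
  have hHc : ∀ n, Continuous (H n) := fun n => continuous_oscInt hΓ (hgHi n)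
  have hFm : ∀ n, Measurable fun x => ‖F n x‖ₑ := fun n => (hFc n).enorm.measurable
  -- On the support of `h n` the normalized frequency lies in the annulus.
  have hann : ∀ n t, h n t ≠ 0 → κ⁻¹ ≤ |r n * a t| ∧ |r n * a t| ≤ κ := by
    intro n t ht
    obtain ⟨h1, h2⟩ := hsupp n t ht
    rw [abs_mul, abs_of_pos (hr0 n), hr]
    simp only
    rw [← div_eq_inv_mul, le_div_iff₀ (hρ n), div_le_iff₀ (hρ n)]
    exact ⟨h1, h2⟩
  have hGder : ∀ n x, HasLineDerivAt ℝ (G n) (ρ n • F n x) x e := by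
    intro n x
    have h1 : (fun t => Complex.I * ((a t : ℝ) : ℂ) * gG n t) = fun t => (ρ n : ℂ) * h n t := by
      ext t
      by_cases ht : h n t = 0
      · simp [hgG, ht]
      · have h2 := hGI _ (hann n t ht).1 (hann n t ht).2
        have h3 : (a t : ℂ) = ρ n * ((r n * a t : ℝ) : ℂ) := by
          rw [← Complex.ofReal_mul, ← mul_assoc, hr, mul_inv_cancel₀ (hρ n).ne', one_mul]
        calc Complex.I * (a t : ℂ) * gG n t
            = ρ n * (Complex.I * ((r n * a t : ℝ) : ℂ) * φG (r n * a t)) * h n t := by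
              rw [h3]; simp only [hgG]; ring
          _ = _ := by rw [h2, mul_one]
    have h2 := hasLineDerivAt_oscInt (e := e) hΓ (hgGi n)
      (by simp only [ha] at h1; rw [h1]; exact (hh n).const_mul _) x
    have h3 : oscInt Γ (fun t => Complex.I * ((a t : ℝ) : ℂ) * gG n t) x = ρ n • F n x := by
      rw [h1, hF, Complex.real_smul]
      simp only [oscInt]
      rw [← integral_const_mul]
      congr 1; ext t; ring
    rw [← h3]
    exact h2
  have hFder : ∀ n x, HasLineDerivAt ℝ (F n) (ρ n • H n x) x e := by
    intro n x
    have h1 : (fun t => Complex.I * ((a t : ℝ) : ℂ) * h n t) = fun t => (ρ n : ℂ) * gH n t := by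
      ext t
      by_cases ht : h n t = 0
      · simp [hgH, ht]
      · have h2 := hHI _ (hann n t ht).2
        have h3 : (a t : ℂ) = ρ n * ((r n * a t : ℝ) : ℂ) := by
          rw [← Complex.ofReal_mul, ← mul_assoc, hr, mul_inv_cancel₀ (hρ n).ne', one_mul]
        simp only [hgH]
        rw [h2, h3]
        ring
    have h2 := hasLineDerivAt_oscInt (e := e) hΓ (hh n)
      (by simp only [ha] at h1; rw [h1]; exact (hgHi n).const_mul _) x
    have h3 : oscInt Γ (fun t => Complex.I * ((a t : ℝ) : ℂ) * h n t) x = ρ n • H n x := by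
      rw [h1, hH, Complex.real_smul]
      simp only [oscInt]
      rw [← integral_const_mul]
      congr 1; ext t; ring
    rw [← h3]
    exact h2
  have hGle : ∀ n x, ‖G n x‖ₑ ≤ ENNReal.ofReal AG * lineAvg e (r n) (fun y => ‖F n y‖ₑ) x :=
    fun n x => hbdG d Γ hΓ (h n) (hh n) (r n) x
  have hHle : ∀ n x, ‖H n x‖ₑ ≤ ENNReal.ofReal AH * lineAvg e (r n) (fun y => ‖F n y‖ₑ) x :=
    fun n x => hbdH d Γ hΓ (h n) (hh n) (r n) x
  have hLq : ∀ (A : ℝ) (n : ℕ) (g : EuclideanSpace ℝ (Fin d) → ℂ),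
      (∀ x, ‖g x‖ₑ ≤ ENNReal.ofReal A * lineAvg e (r n) (fun y => ‖F n y‖ₑ) x) →
      ∫⁻ x, ‖g x‖ₑ ^ q < ⊤ := by
    intro A n g hg
    calc ∫⁻ x, ‖g x‖ₑ ^ q
        ≤ ∫⁻ x, ENNReal.ofReal A ^ q * lineMax e r (fun y => ‖F n y‖ₑ) x ^ q := by
          refine lintegral_mono fun x => ?_
          rw [← ENNReal.mul_rpow_of_nonneg _ _ hq0.le]
          gcongr
          exact (hg x).trans (mul_le_mul_right (lineAvg_le_lineMax _ _ _ _ _) _)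
      _ = ENNReal.ofReal A ^ q * ∫⁻ x, lineMax e r (fun y => ‖F n y‖ₑ) x ^ q :=
          lintegral_const_mul' _ _ (ENNReal.rpow_ne_top_of_nonneg hq0.le ENNReal.ofReal_ne_top)
      _ ≤ ENNReal.ofReal A ^ q * (ENNReal.ofReal C₁ * ∫⁻ x, ‖F n x‖ₑ ^ q) :=
          mul_le_mul_right (hmax₁ d r hr0 _ (hFm n)) _
      _ < ⊤ := ENNReal.mul_lt_top
          (ENNReal.rpow_lt_top_of_nonneg hq0.le ENNReal.ofReal_ne_top)
          (ENNReal.mul_lt_top ENNReal.ofReal_lt_top (hFq n))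
  -- All partial sums are dominated by the maximal function of the full sum.
  set FM : EuclideanSpace ℝ (Fin d) → ℂ := fun x => ∑ n ∈ Finset.range M, F n x with hFM
  have hFMc : Continuous FM := continuous_finsetSum _ fun j _ => hFc j
  have hFMm : Measurable fun x => ‖FM x‖ₑ := hFMc.enorm.measurable
  set W : EuclideanSpace ℝ (Fin d) → ℝ≥0∞ := fun x =>
    ENNReal.ofReal A₀ * lineMax e r (fun y => ‖FM y‖ₑ) x with hW
  have hWm : Measurable W := (measurable_lineMax hFMm).const_mul _
  have hWle : ∀ n ≤ M, ∀ x, ‖∑ j ∈ Finset.range n, F j x‖ₑ ≤ W x := by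
    intro n hn x
    rcases n with _ | n
    · simp
    have h1 := hbd₀ d Γ hΓ (fun t => ∑ j ∈ Finset.range M, h j t)
      (integrable_finsetSum _ fun j _ => hh j) (r n) x
    have h2 : (fun t => φ₀ (r n * a t) * ∑ j ∈ Finset.range M, h j t) =
        fun t => ∑ j ∈ Finset.range (n + 1), h j t := by
      ext t
      rw [Finset.mul_sum]
      symm
      refine (Finset.sum_subset_zero_on_sdiff (Finset.range_mono hn) ?_ ?_)
      · intro j hj
        have hj' : n + 1 ≤ j := by
          have := (Finset.mem_sdiff.1 hj).2
          simpa using this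
        by_cases ht : h j t = 0
        · simp [ht]
        rw [h₀zero, zero_mul]
        have h3 := (hsupp j t ht).1
        have h4 : 2 * κ ^ 2 * ρ n ≤ ρ j := (hlac n).trans (hmono hj')
        rw [abs_mul, abs_of_pos (hr0 n), hr]
        simp only
        rw [← div_eq_inv_mul, le_div_iff₀ (hρ n)]
        refine le_trans ?_ h3
        rw [← div_eq_inv_mul, le_div_iff₀ hκ0]
        calc 2 * κ * ρ n * κ = 2 * κ ^ 2 * ρ n := by ring
          _ ≤ _ := h4
      · intro j hj
        have hj' : j ≤ n := by simpa [Nat.lt_succ_iff] using hj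
        by_cases ht : h j t = 0
        · simp [ht]
        rw [h₀one, one_mul]
        have h3 := (hsupp j t ht).2
        rw [abs_mul, abs_of_pos (hr0 n), hr]
        simp only
        rw [← div_eq_inv_mul, div_le_iff₀ (hρ n)]
        refine h3.trans ?_
        have := hmono hj'
        gcongr
    rw [h2] at h1
    rw [oscInt_finset_sum _ hΓ (fun j _ => hh j)] at h1
    refine h1.trans ?_
    simp only [hW]
    refine mul_le_mul_right ?_ _
    have h3 : (fun y => ‖oscInt Γ (fun t => ∑ j ∈ Finset.range M, h j t) y‖ₑ) =
        fun y => ‖FM y‖ₑ := by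
      ext y
      rw [oscInt_finset_sum _ hΓ (fun j _ => hh j)]
    rw [h3]
    exact lineAvg_le_lineMax _ _ _ _ _
  have htel := lintegral_sum_rpow_le_of_lacunary (μ := volume) hq hρ hlac2 hFc hGc hHc hFder hGder
    hFq (fun n => hLq AG n _ (hGle n)) (fun n => hLq AH n _ (hHle n)) M hWle
  set X : ℝ≥0∞ := ∫⁻ x, ‖FM x‖ₑ ^ q with hX
  have hXtop : X ≠ ⊤ :=
    (lintegral_enorm_sum_rpow_lt_top hq0 _ (fun j _ => hFc j) (fun j _ => hFq j)).ne
  set Q : EuclideanSpace ℝ (Fin d) → ℝ≥0∞ := fun x => ∑ n ∈ Finset.range M, ‖F n x‖ₑ ^ 2 with hQ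
  have hQm : Measurable Q := Finset.measurable_sum _ fun n _ => (hFm n).pow_const 2
  set Y : ℝ≥0∞ := ∫⁻ x, Q x ^ (q / 2) with hY
  set Z : EuclideanSpace ℝ (Fin d) → ℝ≥0∞ := lineMax e r (fun y => W y ^ (q - 2)) with hZ
  have hWpm : Measurable fun x => W x ^ (q - 2) := hWm.pow_const _
  have hZm : Measurable Z := measurable_lineMax hWpm
  have hWX : ∫⁻ x, (W x ^ (q - 2)) ^ (q / (q - 2)) ≤ K₁ * X := by
    calc ∫⁻ x, (W x ^ (q - 2)) ^ (q / (q - 2))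
        = ENNReal.ofReal A₀ ^ q * ∫⁻ x, lineMax e r (fun y => ‖FM y‖ₑ) x ^ q := by
          rw [← lintegral_const_mul' _ _
            (ENNReal.rpow_ne_top_of_nonneg hq0.le ENNReal.ofReal_ne_top)]
          refine lintegral_congr fun x => ?_
          rw [← ENNReal.rpow_mul, mul_div_cancel₀ _ hp.ne', hW,
            ENNReal.mul_rpow_of_nonneg _ _ hq0.le]
      _ ≤ ENNReal.ofReal A₀ ^ q * (ENNReal.ofReal C₁ * X) :=
          mul_le_mul_right (hmax₁ d r hr0 _ hFMm) _
      _ = K₁ * X := by rw [hK₁, mul_assoc]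
  have hZX : ∫⁻ x, Z x ^ (q / (q - 2)) ≤ ENNReal.ofReal C₂ * K₁ * X := by
    refine (hmax₂ d r hr0 _ hWpm).trans ?_
    rw [mul_assoc]
    gcongr
  have hconj : (q / 2).HolderConjugate (q / (q - 2)) := by
    rw [Real.holderConjugate_iff]
    refine ⟨by linarith, ?_⟩
    field_simp
    ring
  have hHolder : ∀ (w : EuclideanSpace ℝ (Fin d) → ℝ≥0∞) (L : ℝ≥0∞), Measurable w →
      ∫⁻ x, w x ^ (q / (q - 2)) ≤ L * X → ∫⁻ x, Q x * w x ≤ L ^ θ * (Y ^ (2 / q) * X ^ θ) := by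
    intro w L hw hwL
    have h1 := ENNReal.lintegral_mul_le_Lp_mul_Lq volume hconj hQm.aemeasurable hw.aemeasurable
    refine h1.trans ?_
    rw [one_div_div, one_div_div]
    calc Y ^ (2 / q) * (∫⁻ x, w x ^ (q / (q - 2))) ^ θ ≤ Y ^ (2 / q) * (L * X) ^ θ := by gcongr
      _ = _ := by rw [ENNReal.mul_rpow_of_nonneg _ _ hθ0.le]; ring
  have hdual : ∀ (A : ℝ) (n : ℕ) (g : EuclideanSpace ℝ (Fin d) → ℂ),
      (∀ x, ‖g x‖ₑ ≤ ENNReal.ofReal A * lineAvg e (r n) (fun y => ‖F n y‖ₑ) x) →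
      ∫⁻ x, ‖g x‖ₑ ^ 2 * W x ^ (q - 2) ≤
        ENNReal.ofReal A ^ 2 * ENNReal.ofReal Real.pi * ∫⁻ x, ‖F n x‖ₑ ^ 2 * Z x := by
    intro A n g hg
    calc ∫⁻ x, ‖g x‖ₑ ^ 2 * W x ^ (q - 2)
        ≤ ∫⁻ x, ENNReal.ofReal A ^ 2 * ENNReal.ofReal Real.pi *
            (lineAvg e (r n) (fun y => ‖F n y‖ₑ ^ 2) x * W x ^ (q - 2)) := by
          refine lintegral_mono fun x => ?_
          rw [← mul_assoc, mul_assoc (ENNReal.ofReal A ^ 2)]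
          gcongr
          calc ‖g x‖ₑ ^ 2 ≤ (ENNReal.ofReal A * lineAvg e (r n) (fun y => ‖F n y‖ₑ) x) ^ 2 := by
                gcongr; exact hg x
            _ ≤ _ := by
                rw [mul_pow]
                gcongr
                exact lineAvg_sq_le (hFm n) x
      _ = ENNReal.ofReal A ^ 2 * ENNReal.ofReal Real.pi *
            ∫⁻ x, ‖F n x‖ₑ ^ 2 * lineAvg e (r n) (fun y => W y ^ (q - 2)) x := by
          rw [lintegral_const_mul' _ _ (ENNReal.mul_ne_top
            (ENNReal.pow_ne_top ENNReal.ofReal_ne_top) ENNReal.ofReal_ne_top),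
            lintegral_lineAvg_mul ((hFm n).pow_const 2) hWpm]
      _ ≤ _ := by
          gcongr with x
          exact lineAvg_le_lineMax _ _ _ _ _
  have hsum : ∫⁻ x, W x ^ (q - 2) *
        ∑ n ∈ Finset.range M, (‖F n x‖ₑ ^ 2 + ‖G n x‖ₑ ^ 2 + ‖H n x‖ₑ ^ 2) ≤
      (∫⁻ x, Q x * W x ^ (q - 2)) + B * ∫⁻ x, Q x * Z x := by
    have hGm : ∀ n, Measurable fun x => ‖G n x‖ₑ := fun n => (hGc n).enorm.measurable
    have hHm : ∀ n, Measurable fun x => ‖H n x‖ₑ := fun n => (hHc n).enorm.measurable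
    calc _ = ∫⁻ x, (Q x * W x ^ (q - 2) + ∑ n ∈ Finset.range M,
          (‖G n x‖ₑ ^ 2 * W x ^ (q - 2) + ‖H n x‖ₑ ^ 2 * W x ^ (q - 2))) := by
          refine lintegral_congr fun x => ?_
          simp only [hQ]
          rw [Finset.sum_mul, ← Finset.sum_add_distrib, Finset.mul_sum]
          refine Finset.sum_congr rfl fun n _ => ?_
          ring
      _ = (∫⁻ x, Q x * W x ^ (q - 2)) + ∑ n ∈ Finset.range M,
          ((∫⁻ x, ‖G n x‖ₑ ^ 2 * W x ^ (q - 2)) + ∫⁻ x, ‖H n x‖ₑ ^ 2 * W x ^ (q - 2)) := by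
          rw [lintegral_add_left (f := fun x => Q x * W x ^ (q - 2)) (hQm.mul hWpm),
            lintegral_finsetSum]
          · congr 1
            refine Finset.sum_congr rfl fun n _ => ?_
            exact lintegral_add_left (((hGm n).pow_const 2).mul hWpm) _
          · intro n _
            exact (((hGm n).pow_const 2).mul hWpm).add (((hHm n).pow_const 2).mul hWpm)
      _ ≤ (∫⁻ x, Q x * W x ^ (q - 2)) + ∑ n ∈ Finset.range M, B * ∫⁻ x, ‖F n x‖ₑ ^ 2 * Z x := by
          gcongr with n _
          rw [hB, add_mul, add_mul]
          exact add_le_add (hdual AG n _ (hGle n)) (hdual AH n _ (hHle n))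
      _ = _ := by
          rw [← Finset.mul_sum, ← lintegral_finsetSum (f := fun n x => ‖F n x‖ₑ ^ 2 * Z x) _
            fun n _ => ((hFm n).pow_const 2).mul hZm]
          simp_rw [← Finset.sum_mul]
          rfl
  have hmain : X ≤ D * Y ^ (2 / q) * X ^ θ := by
    calc X ≤ c * ∫⁻ x, W x ^ (q - 2) *
        ∑ n ∈ Finset.range M, (‖F n x‖ₑ ^ 2 + ‖G n x‖ₑ ^ 2 + ‖H n x‖ₑ ^ 2) := htel
      _ ≤ c * (K₁ ^ θ * (Y ^ (2 / q) * X ^ θ) +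
            B * ((ENNReal.ofReal C₂ * K₁) ^ θ * (Y ^ (2 / q) * X ^ θ))) := by
          gcongr
          refine hsum.trans ?_
          gcongr
          · exact hHolder _ _ hWpm hWX
          · exact hHolder _ _ hZm hZX
      _ = _ := by rw [hD]; ring
  -- Divide by `X ^ θ`, where `1 - θ = 2 / q`.
  by_cases hX0 : X = 0
  · rw [hX0]; exact zero_le
  have hθ1 : 2 / q + θ = 1 := by rw [hθ]; field_simp; ring
  have h1 : X ^ (2 / q) * X ^ θ = X := by
    rw [← ENNReal.rpow_add_of_nonneg _ _ (by positivity) hθ0.le, hθ1, ENNReal.rpow_one]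
  have h2 : X ^ (2 / q) ≤ D * Y ^ (2 / q) := by
    have h3 : X ^ (2 / q) * X ^ θ ≤ D * Y ^ (2 / q) * X ^ θ := by rw [h1]; exact hmain
    refine (ENNReal.mul_le_mul_iff_left ?_ ?_).1 h3
    · exact (ENNReal.rpow_pos (pos_iff_ne_zero.2 hX0) hXtop).ne'
    · exact ENNReal.rpow_ne_top_of_nonneg hθ0.le hXtop
  calc X = (X ^ (2 / q)) ^ (q / 2) := by
        rw [← ENNReal.rpow_mul, show 2 / q * (q / 2) = 1 by field_simp, ENNReal.rpow_one]
    _ ≤ (D * Y ^ (2 / q)) ^ (q / 2) := by gcongr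
    _ = D ^ (q / 2) * Y := by
        rw [ENNReal.mul_rpow_of_nonneg _ _ (by positivity), ← ENNReal.rpow_mul,
          show 2 / q * (q / 2) = 1 by field_simp, ENNReal.rpow_one]

/-! ### Frequencies of the dyadic pieces -/

/-- If `u' ≈ s^l` then `u - c ≈ s^{l+1}` for a suitable constant `c`, even when the interval stays
away from the origin. -/
theorem exists_sub_const_sim_of_deriv_pos {J : Set ℝ} (hJ : J.OrdConnected) (hJ0 : J ⊆ Set.Ici 0)
    {u u' : ℝ → ℝ} (hu : ∀ s, HasDerivAt u (u' s) s) {K B : ℝ} (hK : 0 < K) (hB : 0 < B) {l : ℕ}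
    (h : ∀ s ∈ J, 0 < s → K⁻¹ * (B * s ^ l) ≤ u' s ∧ u' s ≤ K * (B * s ^ l)) :
    ∃ c, ∀ s ∈ J, K⁻¹ * (B / (l + 1) * s ^ (l + 1)) ≤ |u s - c| ∧
      |u s - c| ≤ K * (B / (l + 1) * s ^ (l + 1)) := by
  rcases J.eq_empty_or_nonempty with rfl | ⟨t₀, ht₀⟩
  · exact ⟨0, by simp⟩
  have hpow : ∀ A s : ℝ, HasDerivAt (fun s : ℝ => A * (B / (l + 1) * s ^ (l + 1)))
      (A * (B * s ^ l)) s := by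
    intro A s
    have h1 := ((hasDerivAt_pow (l + 1) s).const_mul (B / (l + 1))).const_mul A
    refine h1.congr_deriv ?_
    have : (l : ℝ) + 1 ≠ 0 := by positivity
    push_cast
    field_simp
  have hder : ∀ A s : ℝ, HasDerivAt (fun s : ℝ => u s - A * (B / (l + 1) * s ^ (l + 1)))
      (u' s - A * (B * s ^ l)) s := fun A s => (hu s).fun_sub (hpow A s)
  have hint : ∀ s ∈ interior J, 0 < s := by
    intro s hs
    have := interior_mono hJ0 hs
    rwa [interior_Ici] at this
  have hmono : MonotoneOn (fun s : ℝ => u s - K⁻¹ * (B / (l + 1) * s ^ (l + 1))) J := by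
    refine monotoneOn_of_deriv_nonneg hJ.convex
      (fun s _ => (hder _ s).continuousAt.continuousWithinAt)
      (fun s _ => (hder _ s).differentiableAt.differentiableWithinAt) fun s hs => ?_
    rw [(hder _ s).deriv]
    linarith [(h s (interior_subset hs) (hint s hs)).1]
  have hanti : AntitoneOn (fun s : ℝ => u s - K * (B / (l + 1) * s ^ (l + 1))) J := by
    refine antitoneOn_of_deriv_nonpos hJ.convex
      (fun s _ => (hder _ s).continuousAt.continuousWithinAt)
      (fun s _ => (hder _ s).differentiableAt.differentiableWithinAt) fun s hs => ?_
    rw [(hder _ s).deriv]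
    linarith [(h s (interior_subset hs) (hint s hs)).2]
  -- Every value of the decreasing function lies below every value of the increasing one, so that
  -- a constant `c` fits in between.
  have hle0 : ∀ s ∈ J, u s - K * (B / (l + 1) * s ^ (l + 1)) ≤
      u s - K⁻¹ * (B / (l + 1) * s ^ (l + 1)) := by
    intro s hs
    rcases (show (0 : ℝ) ≤ s from hJ0 hs).eq_or_lt with h0 | h0
    · simp [← h0]
    · have h1 := (h s hs h0).1.trans (h s hs h0).2
      have h2 : K⁻¹ ≤ K := le_of_mul_le_mul_right h1 (by positivity)
      have : 0 ≤ B / (l + 1) * s ^ (l + 1) := by positivity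
      nlinarith
  have hle : ∀ s ∈ J, ∀ t ∈ J, u s - K * (B / (l + 1) * s ^ (l + 1)) ≤
      u t - K⁻¹ * (B / (l + 1) * t ^ (l + 1)) := by
    intro s hs t ht
    rcases le_total s t with hst | hst
    · exact (hle0 s hs).trans (hmono hs ht hst)
    · exact (hanti ht hs hst).trans (hle0 t ht)
  set v : ℝ → ℝ := fun s => u s - K * (B / (l + 1) * s ^ (l + 1)) with hv
  have hbdd : BddAbove (v '' J) := ⟨_, by
    rintro _ ⟨s, hs, rfl⟩
    exact hle s hs t₀ ht₀⟩
  refine ⟨sSup (v '' J), fun s hs => ?_⟩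
  have h1 : v s ≤ sSup (v '' J) := le_csSup hbdd ⟨s, hs, rfl⟩
  have h2 : sSup (v '' J) ≤ u s - K⁻¹ * (B / (l + 1) * s ^ (l + 1)) := by
    refine csSup_le ⟨_, t₀, ht₀, rfl⟩ ?_
    rintro _ ⟨t, ht, rfl⟩
    exact hle t ht s hs
  have h3 : 0 ≤ K⁻¹ * (B / (l + 1) * s ^ (l + 1)) := by
    have : (0 : ℝ) ≤ s := hJ0 hs
    positivity
  rw [abs_of_nonneg (by linarith)]
  simp only [hv] at h1
  exact ⟨by linarith, by linarith⟩

/-- The version of `exists_sub_const_sim_of_deriv_pos` without a sign: away from the origin `u'`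
does not vanish, so it has a constant sign. -/
theorem exists_sub_const_sim {J : Set ℝ} (hJ : J.OrdConnected) (hJ0 : J ⊆ Set.Ici 0)
    {u u' : ℝ → ℝ} (hu : ∀ s, HasDerivAt u (u' s) s) (hu' : Continuous u') {K B : ℝ} (hK : 0 < K)
    (hB : 0 < B) {l : ℕ}
    (h : ∀ s ∈ J, K⁻¹ * (B * s ^ l) ≤ |u' s| ∧ |u' s| ≤ K * (B * s ^ l)) :
    ∃ c, ∀ s ∈ J, K⁻¹ * (B / (l + 1) * s ^ (l + 1)) ≤ |u s - c| ∧
      |u s - c| ≤ K * (B / (l + 1) * s ^ (l + 1)) := by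
  have hpre : IsPreconnected (J ∩ Set.Ioi 0) := (hJ.inter Set.ordConnected_Ioi).isPreconnected
  have hne : ∀ s ∈ J ∩ Set.Ioi 0, u' s ≠ 0 := by
    rintro s ⟨hs, hs0⟩ h0
    have h1 := (h s hs).1
    have hs0 : 0 < s := hs0
    rw [h0, abs_zero] at h1
    have : 0 < K⁻¹ * (B * s ^ l) := by positivity
    linarith
  by_cases hsign : ∀ s ∈ J ∩ Set.Ioi 0, 0 < u' s
  · refine exists_sub_const_sim_of_deriv_pos hJ hJ0 hu hK hB fun s hs hs0 => ?_
    have := h s hs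
    rwa [abs_of_pos (hsign s ⟨hs, hs0⟩)] at this
  · push Not at hsign
    obtain ⟨s₁, hs₁, hneg⟩ := hsign
    have hall : ∀ s ∈ J ∩ Set.Ioi 0, u' s < 0 := by
      intro s hs
      by_contra hcon
      obtain ⟨z, hz, hz0⟩ := hpre.intermediate_value hs₁ hs hu'.continuousOn
        (show (0 : ℝ) ∈ Set.Icc (u' s₁) (u' s) from ⟨hneg, not_lt.1 hcon⟩)
      exact hne z hz hz0
    obtain ⟨c, hc⟩ := exists_sub_const_sim_of_deriv_pos hJ hJ0 (u := fun s => -u s)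
      (u' := fun s => -u' s) (fun s => (hu s).fun_neg) hK hB fun s hs hs0 => by
        have := h s hs
        rwa [abs_of_neg (hall s ⟨hs, hs0⟩)] at this
    refine ⟨-c, fun s hs => ?_⟩
    have := hc s hs
    rwa [show |u s - -c| = |-u s - c| by rw [← abs_neg]; ring_nf]

/-- The first coordinate of the curve, minus a constant, is comparable to a power of the distance
to the center. -/
theorem IsDWInterval.exists_first_coordinate_sim {d : ℕ} [NeZero d] {N : ℕ} {K : ℝ}
    {γ : Fin d → ℝ[X]} {I : Set ℝ} {b : ℝ} (hI : IsDWInterval N K γ I b) (hK : 0 < K) :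
    ∃ c D : ℝ, 0 < D ∧ ∃ l ≤ N, ∀ t ∈ I,
      K⁻¹ * (D * |t - b| ^ (l + 1)) ≤ |(γ 0).eval t - c| ∧
      |(γ 0).eval t - c| ≤ K * (D * |t - b| ^ (l + 1)) := by
  obtain ⟨B, hB, l, hl, h⟩ := hI.deriv_sim
  have hside : (∀ t ∈ I, b ≤ t) ∨ (∀ t ∈ I, t ≤ b) := by
    by_contra! hcon
    obtain ⟨⟨t₁, ht₁, hb₁⟩, ⟨t₂, ht₂, hb₂⟩⟩ := hcon
    refine hI.center (mem_interior.2 ⟨Set.Ioo t₁ t₂, ?_, isOpen_Ioo, ⟨hb₁, hb₂⟩⟩)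
    exact Set.Ioo_subset_Icc_self.trans (hI.ordConnected.out ht₁ ht₂)
  obtain ⟨ε, hε, hεI⟩ : ∃ ε : ℝ, |ε| = 1 ∧ ∀ t ∈ I, 0 ≤ ε * (t - b) := by
    rcases hside with h' | h'
    · exact ⟨1, by simp, fun t ht => by linarith [h' t ht]⟩
    · exact ⟨-1, by simp, fun t ht => by linarith [h' t ht]⟩
  have hε2 : ε * ε = 1 := by rw [← abs_mul_abs_self, hε, one_mul]
  set J : Set ℝ := {s | 0 ≤ s ∧ b + ε * s ∈ I} with hJ
  have hJo : J.OrdConnected := by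
    refine ⟨fun s hs t ht z hz => ⟨hs.1.trans hz.1, ?_⟩⟩
    rcases (abs_eq zero_le_one).1 hε with rfl | rfl
    · exact hI.ordConnected.out hs.2 ht.2 ⟨by linarith [hz.1], by linarith [hz.2]⟩
    · exact hI.ordConnected.out ht.2 hs.2 ⟨by linarith [hz.2], by linarith [hz.1]⟩
  have habs : ∀ s, |ε * s| = |s| := fun s => by rw [abs_mul, hε, one_mul]
  obtain ⟨c, hc⟩ := exists_sub_const_sim hJo (fun s hs => hs.1)
    (u := fun s => (γ 0).eval (b + ε * s))
    (u' := fun s => (derivative (γ 0)).eval (b + ε * s) * ε)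
    (fun s => by
      have h1 : HasDerivAt (fun s : ℝ => b + ε * s) ε s := by
        simpa using ((hasDerivAt_id s).const_mul ε).const_add b
      exact ((γ 0).hasDerivAt (b + ε * s)).comp s h1)
    (by fun_prop) hK hB (l := l) (fun s hs => by
      have h1 := h _ hs.2
      rw [add_sub_cancel_left, habs, abs_of_nonneg hs.1] at h1
      rwa [abs_mul, hε, mul_one])
  refine ⟨c, B / (l + 1), by positivity, l, hl, fun t ht => ?_⟩
  have h1 : b + ε * (ε * (t - b)) = t := by rw [← mul_assoc, hε2]; ring
  have h2 := hc (ε * (t - b)) ⟨hεI t ht, by rw [h1]; exact ht⟩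
  simp only [h1] at h2
  rwa [← abs_of_nonneg (hεI t ht), habs] at h2

/-- The frequencies of the piece `I_n` in the first direction, after a translation, lie in an
annulus with ratio depending only on `K` and `N`. -/
theorem IsDWInterval.exists_annuli {d : ℕ} [NeZero d] {N : ℕ} {K : ℝ}
    {γ : Fin d → ℝ[X]} {I : Set ℝ} {b : ℝ} (hI : IsDWInterval N K γ I b) (hK : 0 < K) :
    ∃ (c : ℝ) (ρ : ℤ → ℝ), (∀ n, 0 < ρ n) ∧ (∀ n (m : ℕ), 2 ^ m * ρ n ≤ ρ (n + m)) ∧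
      ∀ n, ∀ t ∈ dyadicPiece I b n,
        (K * 2 ^ (N + 1))⁻¹ * ρ n ≤ |(γ 0).eval t - c| ∧
        |(γ 0).eval t - c| ≤ K * 2 ^ (N + 1) * ρ n := by
  obtain ⟨c, D, hD, l, hl, h⟩ := hI.exists_first_coordinate_sim hK
  refine ⟨c, fun n => D * ((2 : ℝ) ^ n) ^ (l + 1), fun n => by positivity, fun n m => ?_,
    fun n t ht => ?_⟩
  · beta_reduce
    rw [zpow_add₀ (by norm_num), mul_pow, zpow_natCast]
    have h1 : (2 : ℝ) ^ m ≤ (2 ^ m) ^ (l + 1) :=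
      le_self_pow₀ (one_le_pow₀ (by norm_num)) (by omega)
    calc (2 : ℝ) ^ m * (D * (2 ^ n) ^ (l + 1))
        ≤ (2 ^ m) ^ (l + 1) * (D * (2 ^ n) ^ (l + 1)) := by gcongr
      _ = _ := by ring
  · obtain ⟨htI, h1, h2⟩ := ht
    obtain ⟨h3, h4⟩ := h t htI
    have h5 : (2 : ℝ) ^ (l + 1) ≤ 2 ^ (N + 1) :=
      pow_le_pow_right₀ (by norm_num) (by omega)
    constructor
    · calc (K * 2 ^ (N + 1))⁻¹ * (D * (2 ^ n) ^ (l + 1))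
          ≤ K⁻¹ * (D * |t - b| ^ (l + 1)) := by
            gcongr
            exact le_mul_of_one_le_right hK.le (one_le_pow₀ (by norm_num))
        _ ≤ _ := h3
    · calc _ ≤ K * (D * |t - b| ^ (l + 1)) := h4
        _ ≤ K * (D * (2 ^ (n + 1)) ^ (l + 1)) := by gcongr
        _ = K * 2 ^ (l + 1) * (D * (2 ^ n) ^ (l + 1)) := by
            rw [zpow_add₀ (by norm_num), mul_pow, zpow_one]; ring
        _ ≤ _ := by gcongr

/-! ### Integrability against the affine arclength -/

section
variable {d : ℕ}

@[fun_prop]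
theorem continuous_curve (γ : Fin d → ℝ[X]) : Continuous (curve γ) := by
  unfold curve
  exact (PiLp.continuous_toLp 2 _).comp (continuous_pi fun i => (γ i).continuous)

/-- The torsion as a polynomial. -/
noncomputable def torsionPoly (γ : Fin d → ℝ[X]) : ℝ[X] :=
  Matrix.det (Matrix.of fun i j : Fin d => derivative^[(j : ℕ) + 1] (γ i))

theorem eval_torsionPoly (γ : Fin d → ℝ[X]) (t : ℝ) : (torsionPoly γ).eval t = torsion γ t := by
  unfold torsionPoly torsion
  rw [← coe_evalRingHom, RingHom.map_det]
  rfl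

theorem continuous_torsion (γ : Fin d → ℝ[X]) : Continuous (torsion γ) := by
  have : torsion γ = fun t => (torsionPoly γ).eval t := funext fun t => (eval_torsionPoly γ t).symm
  rw [this]
  exact (torsionPoly γ).continuous

theorem weight_nonneg (γ : Fin d → ℝ[X]) (t : ℝ) : 0 ≤ weight γ t :=
  Real.rpow_nonneg (abs_nonneg _) _

@[fun_prop]
theorem continuous_weight (γ : Fin d → ℝ[X]) : Continuous (weight γ) :=
  (continuous_torsion γ).abs.rpow_const fun _ => Or.inr (by positivity)

theorem weight_le [NeZero d] (γ : Fin d → ℝ[X]) (t : ℝ) : weight γ t ≤ 1 + torsion γ t ^ 2 := by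
  have hd : (1 : ℝ) ≤ d := by exact_mod_cast NeZero.one_le
  have h1 : (2 : ℝ) / ((d : ℝ) * ((d : ℝ) + 1)) ≤ 1 := by
    rw [div_le_one (by positivity)]; nlinarith
  unfold weight
  rcases le_total |torsion γ t| 1 with h | h
  · have := Real.rpow_le_one (abs_nonneg _) h
      (by positivity : 0 ≤ (2 : ℝ) / ((d : ℝ) * ((d : ℝ) + 1)))
    nlinarith [sq_nonneg (torsion γ t)]
  · have h2 : |torsion γ t| ^ ((2 : ℝ) / ((d : ℝ) * ((d : ℝ) + 1))) ≤ |torsion γ t| := by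
      simpa using Real.rpow_le_rpow_of_exponent_le h h1
    nlinarith [sq_abs (torsion γ t)]

theorem integrable_affineArclength_iff (γ : Fin d → ℝ[X]) (g : ℝ → ℂ) :
    Integrable g (affineArclength γ) ↔ Integrable fun t => g t * (weight γ t : ℂ) := by
  unfold affineArclength
  rw [integrable_withDensity_iff_integrable_smul' (by fun_prop)
    (Filter.Eventually.of_forall fun t => ENNReal.ofReal_lt_top)]
  simp_rw [ENNReal.toReal_ofReal (weight_nonneg γ _), Complex.real_smul, mul_comm]

instance (γ : Fin d → ℝ[X]) : IsLocallyFiniteMeasure (affineArclength γ) :=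
  IsLocallyFiniteMeasure.withDensity_ofReal (continuous_weight γ)

theorem integrable_indicator_mul_weight (γ : Fin d → ℝ[X]) {p : ℝ} (hp : 1 < p) {f : ℝ → ℂ}
    (hf : MemLp f (ENNReal.ofReal p) (affineArclength γ)) {s : Set ℝ} (hs : MeasurableSet s)
    (hb : Bornology.IsBounded s) : Integrable fun t => s.indicator f t * (weight γ t : ℂ) := by
  rw [← integrable_affineArclength_iff, integrable_indicator_iff hs]
  have h1 : LocallyIntegrable f (affineArclength γ) :=
    hf.locallyIntegrable (by simpa using hp.le)
  exact (h1.integrableOn_isCompact hb.isCompact_closure).mono_set subset_closure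

end

theorem exists_isBigO_pow_of_natDegree_pos {P : ℝ[X]} (hP : 0 < P.natDegree) (Q : ℝ[X]) :
    ∃ k : ℕ, (fun t => Q.eval t) =O[Filter.cocompact ℝ] fun t => P.eval t ^ k := by
  have h1 : Q.degree ≤ (P ^ Q.natDegree).degree := by
    have hP0 : P ≠ 0 := by rintro rfl; simp at hP
    refine degree_le_natDegree.trans ?_
    rw [degree_eq_natDegree (pow_ne_zero _ hP0), natDegree_pow]
    exact_mod_cast Nat.le_mul_of_pos_right _ hP
  refine ⟨Q.natDegree, ?_⟩
  rw [← Metric.cobounded_eq_cocompact]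
  simpa using Polynomial.isBigO_cobounded_of_degree_le h1

/-- The Fourier transform of a test function along the curve. -/
noncomputable def curveTransform {d : ℕ} (γ : Fin d → ℝ[X]) (φ : EuclideanSpace ℝ (Fin d) → ℂ)
    (t : ℝ) : ℂ :=
  ∫ x, wave γ x t * φ x

section
variable {d : ℕ} {γ : Fin d → ℝ[X]} {φ : EuclideanSpace ℝ (Fin d) → ℂ}

theorem continuous_and_decay_curveTransform (hφ : ContDiff ℝ ∞ φ) (hφc : HasCompactSupport φ) :
    Continuous (curveTransform γ φ) ∧
      ∀ k : ℕ, ∃ C : ℝ, ∀ t, ‖curve γ t‖ ^ k * ‖curveTransform γ φ t‖ ≤ C := by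
  set ψ : SchwartzMap (EuclideanSpace ℝ (Fin d)) ℂ :=
    FourierTransform.fourier (hφc.toSchwartzMap hφ) with hψ
  have h1 : ∀ t, curveTransform γ φ t = ψ (-(2 * Real.pi)⁻¹ • curve γ t) := by
    intro t
    rw [hψ, SchwartzMap.fourier_coe, Real.fourier_eq']
    unfold curveTransform
    refine integral_congr_ae (Filter.Eventually.of_forall fun x => ?_)
    simp only [wave, smul_eq_mul]
    congr 2
    rw [inner_smul_right]
    push_cast
    have : (Real.pi : ℂ) ≠ 0 := by exact_mod_cast Real.pi_ne_zero
    field_simp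
  constructor
  · have : curveTransform γ φ = fun t => ψ (-(2 * Real.pi)⁻¹ • curve γ t) := funext h1
    rw [this]
    have := ψ.continuous
    fun_prop
  · intro k
    obtain ⟨C, hC⟩ := ψ.decay k 0
    refine ⟨(2 * Real.pi) ^ k * C, fun t => ?_⟩
    have h2 := hC.2 (-(2 * Real.pi)⁻¹ • curve γ t)
    rw [norm_iteratedFDeriv_zero, norm_smul, norm_neg, Real.norm_of_nonneg (by positivity),
      mul_pow, ← h1] at h2
    have h3 : (2 * Real.pi) ^ k * ((2 * Real.pi)⁻¹ ^ k * ‖curve γ t‖ ^ k * ‖curveTransform γ φ t‖)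
        ≤ (2 * Real.pi) ^ k * C := by gcongr
    refine le_trans (le_of_eq ?_) h3
    rw [inv_pow, mul_assoc, mul_inv_cancel_left₀ (by positivity)]

theorem abs_eval_le_norm_curve (γ : Fin d → ℝ[X]) (i : Fin d) (t : ℝ) :
    |(γ i).eval t| ≤ ‖curve γ t‖ := by
  have := PiLp.norm_apply_le (curve γ t) i
  simpa [curve] using this

/-- The Fourier transform of a test function decays along a curve that escapes to infinity. -/
theorem integrable_curveTransform [NeZero d] (hγ : 0 < (γ 0).natDegree) (hφ : ContDiff ℝ ∞ φ)
    (hφc : HasCompactSupport φ) : Integrable (curveTransform γ φ) (affineArclength γ) := by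
  obtain ⟨hcont, hdec⟩ := continuous_and_decay_curveTransform (γ := γ) hφ hφc
  rw [integrable_affineArclength_iff]
  have hc2 : Continuous fun t => curveTransform γ φ t * (weight γ t : ℂ) := by fun_prop
  obtain ⟨k, hk⟩ := exists_isBigO_pow_of_natDegree_pos hγ
    ((1 + X ^ 2) * (1 + torsionPoly γ ^ 2))
  obtain ⟨C, hC⟩ := hdec k
  have hO : (fun t => curveTransform γ φ t * (weight γ t : ℂ)) =O[Filter.cocompact ℝ]
      fun t => (1 + t ^ 2)⁻¹ := by
    obtain ⟨c, hc⟩ := hk.bound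
    refine Asymptotics.IsBigO.of_bound (|c| * C) (hc.mono fun t ht => ?_)
    simp only [eval_mul, eval_add, eval_one, eval_pow, eval_X, eval_torsionPoly, norm_mul,
      norm_pow, Real.norm_eq_abs] at ht
    have h1 : |1 + t ^ 2| = 1 + t ^ 2 := abs_of_pos (by positivity)
    have h2 : |1 + torsion γ t ^ 2| = 1 + torsion γ t ^ 2 := abs_of_pos (by positivity)
    rw [h1, h2] at ht
    rw [norm_mul, Complex.norm_real, Real.norm_of_nonneg (weight_nonneg γ t),
      Real.norm_of_nonneg (by positivity), ← div_eq_mul_inv, le_div_iff₀ (by positivity)]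
    calc ‖curveTransform γ φ t‖ * weight γ t * (1 + t ^ 2)
        ≤ ‖curveTransform γ φ t‖ * ((1 + t ^ 2) * (1 + torsion γ t ^ 2)) := by
          rw [mul_assoc, mul_comm (weight γ t)]
          gcongr
          exact weight_le γ t
      _ ≤ ‖curveTransform γ φ t‖ * (|c| * ‖curve γ t‖ ^ k) := by
          refine mul_le_mul_of_nonneg_left (ht.trans ?_) (norm_nonneg _)
          gcongr
          · exact le_abs_self c
          · exact abs_eval_le_norm_curve γ 0 t
      _ = |c| * (‖curve γ t‖ ^ k * ‖curveTransform γ φ t‖) := by ring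
      _ ≤ |c| * C := by gcongr; exact hC t
  refine hc2.locallyIntegrable.integrable_of_isBigO_cocompact hO ?_
  exact integrable_inv_one_add_sq.integrableAtFilter _

/-- The pairing of `f ∈ L^p(λ dt)` with a test function converges absolutely. -/
theorem integrable_mul_curveTransform [NeZero d] (hγ : 0 < (γ 0).natDegree)
    (hφ : ContDiff ℝ ∞ φ) (hφc : HasCompactSupport φ) {p : ℝ} (hp : 1 < p) {f : ℝ → ℂ}
    (hf : MemLp f (ENNReal.ofReal p) (affineArclength γ)) :
    Integrable fun t => f t * (weight γ t : ℂ) * curveTransform γ φ t := by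
  obtain ⟨hcont, hdec⟩ := continuous_and_decay_curveTransform (γ := γ) hφ hφc
  have hψ := integrable_curveTransform hγ hφ hφc
  obtain ⟨C, hC⟩ := hdec 0
  have hfp := hf.integrable_norm_rpow (by simp; linarith) ENNReal.ofReal_ne_top
  rw [ENNReal.toReal_ofReal (by linarith)] at hfp
  have key : Integrable (fun t => f t * curveTransform γ φ t) (affineArclength γ) := by
    refine ((hfp.mul_const C).add hψ.norm).mono'
      (hf.1.mul hcont.aestronglyMeasurable) (Filter.Eventually.of_forall fun t => ?_)
    have h1 := hC t
    rw [pow_zero, one_mul] at h1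
    have h2 : ‖f t‖ ≤ ‖f t‖ ^ p + 1 := by
      rcases le_total ‖f t‖ 1 with h | h
      · have := Real.rpow_nonneg (norm_nonneg (f t)) p
        linarith
      · have := Real.rpow_le_rpow_of_exponent_le h hp.le
        rw [Real.rpow_one] at this
        linarith
    have h3 := Real.rpow_nonneg (norm_nonneg (f t)) p
    calc ‖f t * curveTransform γ φ t‖ = ‖f t‖ * ‖curveTransform γ φ t‖ := norm_mul _ _
      _ ≤ (‖f t‖ ^ p + 1) * ‖curveTransform γ φ t‖ := by gcongr
      _ = ‖f t‖ ^ p * ‖curveTransform γ φ t‖ + ‖curveTransform γ φ t‖ := by ring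
      _ ≤ _ := by
        simp only [Pi.add_apply]
        gcongr
  rw [integrable_affineArclength_iff] at key
  refine key.congr (Filter.Eventually.of_forall fun t => ?_)
  simp only
  ring

/-- Fubini's theorem for the pairing of an oscillatory integral with a test function. -/
theorem integral_oscInt_mul (hφ : Continuous φ) (hφc : HasCompactSupport φ) {h : ℝ → ℂ}
    (hh : Integrable h) :
    ∫ x, oscInt (curve γ) h x * φ x = ∫ t, h t * curveTransform γ φ t := by
  have hφi : Integrable φ := hφ.integrable_of_hasCompactSupport hφc
  unfold oscInt curveTransform wave
  simp_rw [← integral_mul_const, ← integral_const_mul]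
  rw [integral_integral_swap]
  · congr 1; ext t; congr 1; ext x; ring
  · refine (hφi.mul_prod hh).mono ?_ (Filter.Eventually.of_forall fun z => ?_)
    · have h1 : AEStronglyMeasurable (fun z : EuclideanSpace ℝ (Fin d) × ℝ => Complex.exp
          (Complex.I * ((inner ℝ z.1 (curve γ z.2) : ℝ) : ℂ))) (volume.prod volume) :=
        Continuous.aestronglyMeasurable (by fun_prop)
      exact (h1.mul hh.aestronglyMeasurable.comp_snd).mul hφi.aestronglyMeasurable.comp_fst
    · simp only [Function.uncurry, norm_mul, norm_exp_I_mul_ofReal, one_mul]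
      rw [mul_comm]

end

theorem extOp_eq_oscInt {d : ℕ} (γ : Fin d → ℝ[X]) (g : ℝ → ℂ) :
    extOp γ g = oscInt (curve γ) fun t => g t * (weight γ t : ℂ) := by
  ext x
  unfold extOp oscInt wave
  congr 1; ext t; ring

/-- Translating the curve modulates the oscillatory integral. -/
theorem enorm_oscInt_sub_const {E : Type*} [NormedAddCommGroup E] [InnerProductSpace ℝ E]
    (Γ : ℝ → E) (v : E) {ι : Type*} (s : Finset ι) (h : ι → ℝ → ℂ) (x : E) :
    ‖∑ i ∈ s, oscInt (fun t => Γ t - v) (h i) x‖ₑ = ‖∑ i ∈ s, oscInt Γ (h i) x‖ₑ := by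
  have h1 : ∀ i, oscInt (fun t => Γ t - v) (h i) x =
      Complex.exp (Complex.I * ((-inner ℝ x v : ℝ) : ℂ)) * oscInt Γ (h i) x := by
    intro i
    unfold oscInt
    rw [← integral_const_mul]
    congr 1; ext t
    rw [← mul_assoc, ← Complex.exp_add, inner_sub_right]
    congr 2
    push_cast
    ring
  simp_rw [h1, ← Finset.mul_sum]
  rw [enorm_mul, ← ofReal_norm, norm_exp_I_mul_ofReal]
  simp

/-! ### Unconditional summation in `L^q` from a square function bound -/

section
variable {ι α : Type*} [MeasurableSpace α] {μ : Measure α} {q : ℝ} {F : ι → α → ℂ}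

theorem memLp_of_squareFunction (hq : 0 < q) (hFm : ∀ n, Measurable (F n))
    (hS : ∫⁻ x, (∑' n, ‖F n x‖ₑ ^ 2) ^ (q / 2) ∂μ ≠ ⊤) (n : ι) :
    MemLp (F n) (ENNReal.ofReal q) μ := by
  refine ⟨(hFm n).aestronglyMeasurable, ?_⟩
  rw [eLpNorm_lt_top_iff_lintegral_rpow_enorm_lt_top (by simpa using hq) ENNReal.ofReal_ne_top,
    ENNReal.toReal_ofReal hq.le]
  refine lt_of_le_of_lt (lintegral_mono fun x => ?_) hS.lt_top
  calc ‖F n x‖ₑ ^ q = (‖F n x‖ₑ ^ 2) ^ (q / 2) := by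
        rw [← ENNReal.rpow_natCast, ← ENNReal.rpow_mul]
        congr 1
        push_cast
        ring
    _ ≤ _ := by
        gcongr
        exact ENNReal.le_tsum (f := fun n => ‖F n x‖ₑ ^ 2) n

/-- If the `L^q` norms of the finite partial sums are controlled by those of their square
functions, and the full square function is in `L^q`, then the series converges unconditionally in
`L^q`: the square functions of the tails tend to zero by dominated convergence. -/
theorem exists_hasSum_of_squareFunction [Countable ι] (hq : 1 ≤ q)
    [Fact (1 ≤ ENNReal.ofReal q)] (hFm : ∀ n, Measurable (F n))
    (hF : ∀ n, MemLp (F n) (ENNReal.ofReal q) μ)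
    (hS : ∫⁻ x, (∑' n, ‖F n x‖ₑ ^ 2) ^ (q / 2) ∂μ ≠ ⊤) {C : ℝ≥0}
    (hC : ∀ s : Finset ι, eLpNorm (fun x => ∑ n ∈ s, F n x) (ENNReal.ofReal q) μ ≤
      C * (∫⁻ x, (∑ n ∈ s, ‖F n x‖ₑ ^ 2) ^ (q / 2) ∂μ) ^ (1 / q)) :
    ∃ G : Lp ℂ (ENNReal.ofReal q) μ, HasSum (fun n => (hF n).toLp (F n)) G ∧
      ‖G‖ₑ ≤ C * (∫⁻ x, (∑' n, ‖F n x‖ₑ ^ 2) ^ (q / 2) ∂μ) ^ (1 / q) := by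
  have hq0 : 0 < q := by linarith
  have hsq : ∀ n, Measurable fun x => ‖F n x‖ₑ ^ 2 := fun n => (hFm n).enorm.pow_const 2
  have hnorm : ∀ s : Finset ι, ‖∑ n ∈ s, (hF n).toLp (F n)‖ₑ =
      eLpNorm (fun x => ∑ n ∈ s, F n x) (ENNReal.ofReal q) μ := by
    intro s
    rw [Lp.enorm_def]
    refine eLpNorm_congr_ae ?_
    have h1 : ∀ᵐ x ∂μ, ∀ n ∈ s, (hF n).toLp (F n) x = F n x :=
      (ae_ball_iff s.countable_toSet).2 fun n _ => (hF n).coeFn_toLp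
    filter_upwards [h1, Lp.coeFn_finsetSum s fun n => (hF n).toLp (F n)] with x hx hx2
    rw [hx2, Finset.sum_apply]
    exact Finset.sum_congr rfl fun n hn => hx n hn
  have htail : Filter.Tendsto (fun s : Finset ι =>
      (C : ℝ≥0∞) * (∫⁻ x, (∑' n : {n // n ∉ s}, ‖F n x‖ₑ ^ 2) ^ (q / 2) ∂μ) ^ (1 / q))
      Filter.atTop (nhds 0) := by
    have h0 : Filter.Tendsto (fun s : Finset ι =>
        ∫⁻ x, (∑' n : {n // n ∉ s}, ‖F n x‖ₑ ^ 2) ^ (q / 2) ∂μ) Filter.atTop (nhds 0) := by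
      rw [← lintegral_zero (μ := μ)]
      refine tendsto_lintegral_filter_of_dominated_convergence
        (fun x => (∑' n, ‖F n x‖ₑ ^ 2) ^ (q / 2)) ?_ ?_ hS ?_
      · exact Filter.Eventually.of_forall fun s =>
          (Measurable.tsum fun n : {n // n ∉ s} => hsq n).pow_const _
      · refine Filter.Eventually.of_forall fun s => Filter.Eventually.of_forall fun x => ?_
        gcongr
        exact ENNReal.tsum_comp_le_tsum_of_injective Subtype.val_injective
          fun n => ‖F n x‖ₑ ^ 2
      · filter_upwards [ae_lt_top ((Measurable.tsum hsq).pow_const _) hS] with x hx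
        have h1 : ∑' n, ‖F n x‖ₑ ^ 2 ≠ ⊤ := by
          intro h
          rw [h, ENNReal.top_rpow_of_pos (by positivity)] at hx
          exact lt_irrefl _ hx
        have h2 := (ENNReal.tendsto_tsum_compl_atTop_zero h1).ennrpow_const (q / 2)
        rwa [ENNReal.zero_rpow_of_pos (by positivity)] at h2
    have h3 := ENNReal.Tendsto.const_mul (a := (C : ℝ≥0∞)) (h0.ennrpow_const (1 / q))
      (Or.inr ENNReal.coe_ne_top)
    rwa [ENNReal.zero_rpow_of_pos (by positivity), mul_zero] at h3
  have hsum : Summable fun n => (hF n).toLp (F n) := by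
    rw [summable_iff_vanishing_norm]
    intro ε hε
    obtain ⟨s, hs⟩ := (htail.eventually_lt_const (ENNReal.ofReal_pos.2 hε)).exists
    refine ⟨s, fun t ht => ?_⟩
    rw [← ENNReal.ofReal_lt_ofReal_iff hε, ofReal_norm, hnorm]
    refine (hC t).trans_lt (lt_of_le_of_lt ?_ hs)
    gcongr with x
    have hinj : Function.Injective fun n : t => (⟨n, Finset.disjoint_left.1 ht n.2⟩ : {n // n ∉ s}) :=
      fun a b hab => Subtype.ext (by simpa using hab)
    rw [← Finset.sum_coe_sort, ← tsum_fintype (L := SummationFilter.unconditional _)]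
    exact ENNReal.tsum_comp_le_tsum_of_injective hinj fun n => ‖F n x‖ₑ ^ 2
  obtain ⟨G, hG⟩ := hsum
  refine ⟨G, hG, le_of_tendsto hG.enorm (Filter.Eventually.of_forall fun s => ?_)⟩
  rw [hnorm]
  refine (hC s).trans ?_
  gcongr with x
  exact ENNReal.sum_le_tsum s

end

/-! ### The dyadic pieces -/

section
variable {I : Set ℝ} {b : ℝ}

theorem measurableSet_dyadicPiece (hI : I.OrdConnected) (n : ℤ) :
    MeasurableSet (dyadicPiece I b n) := by
  have : dyadicPiece I b n =
      I ∩ (fun t => |t - b|) ⁻¹' Set.Ico ((2 : ℝ) ^ n) ((2 : ℝ) ^ (n + 1)) := rfl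
  rw [this]
  exact hI.measurableSet.inter (measurableSet_Ico.preimage (by fun_prop))

theorem isBounded_dyadicPiece (n : ℤ) : Bornology.IsBounded (dyadicPiece I b n) := by
  refine (Metric.isBounded_ball (x := b) (r := (2 : ℝ) ^ (n + 1))).subset fun t ht => ?_
  rw [Metric.mem_ball, Real.dist_eq]
  exact ht.2.2

theorem pairwise_disjoint_dyadicPiece :
    Pairwise (Function.onFun Disjoint (dyadicPiece I b)) := by
  intro m n hmn
  refine Set.disjoint_left.2 fun t hm hn => hmn ?_
  have h1 := (zpow_lt_zpow_iff_right₀ one_lt_two).1 (hm.2.1.trans_lt hn.2.2)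
  have h2 := (zpow_lt_zpow_iff_right₀ one_lt_two).1 (hn.2.1.trans_lt hm.2.2)
  omega

theorem iUnion_dyadicPiece : ⋃ n, dyadicPiece I b n = I \ {b} := by
  ext t
  simp only [Set.mem_iUnion, Set.mem_sdiff, Set.mem_singleton_iff]
  constructor
  · rintro ⟨n, h1, h2, -⟩
    refine ⟨h1, fun h => ?_⟩
    rw [h, sub_self, abs_zero] at h2
    exact absurd h2 (not_le.2 (by positivity))
  · rintro ⟨h1, h2⟩
    obtain ⟨n, hn⟩ := exists_mem_Ico_zpow (abs_pos.2 (sub_ne_zero.2 h2)) one_lt_two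
    exact ⟨n, h1, hn⟩

end

/-! ### Finite sums of dyadic pieces -/

theorem sum_range_mul_eq {M : Type*} [AddCommMonoid M] (F : ℕ → M) (R m : ℕ) :
    ∑ i ∈ Finset.range (R * m), F i =
      ∑ j ∈ Finset.range R, ∑ k ∈ Finset.range m, F (j + R * k) := by
  induction m with
  | zero => simp
  | succ m ih =>
    rw [mul_add, mul_one, Finset.sum_range_add, ih, ← Finset.sum_add_distrib]
    refine Finset.sum_congr rfl fun j _ => ?_
    rw [Finset.sum_range_succ, add_comm j (R * m)]

/-- The reverse square function estimate for finitely many pieces. Splitting the indices modulo a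
fixed `R` makes the annuli as sparse as `lintegral_sum_oscInt_rpow_le` demands. -/
theorem exists_eLpNorm_sum_extOp_le {q : ℝ} (hq : 2 < q) {K : ℝ} (hK : 1 ≤ K) (N : ℕ) :
    ∃ C : ℝ≥0, ∀ (d : ℕ) [NeZero d] (γ : Fin d → ℝ[X]) (I : Set ℝ) (b : ℝ),
      IsDWInterval N K γ I b → ∀ (p : ℝ) (f : ℝ → ℂ), 1 < p →
      MemLp f (ENNReal.ofReal p) (affineArclength γ) →
      (∀ n, ∫⁻ x, ‖extOp γ ((dyadicPiece I b n).indicator f) x‖ₑ ^ q < ⊤) →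
      ∀ s : Finset ℤ,
        eLpNorm (fun x => ∑ n ∈ s, extOp γ ((dyadicPiece I b n).indicator f) x)
            (ENNReal.ofReal q) volume ≤
          C * (∫⁻ x, (∑ n ∈ s, ‖extOp γ ((dyadicPiece I b n).indicator f) x‖ₑ ^ 2) ^ (q / 2)) ^
            (1 / q) := by
  set κ : ℝ := K * 2 ^ (N + 1) with hκ
  have hκ1 : 1 ≤ κ := one_le_mul_of_one_le_of_one_le hK (one_le_pow₀ (by norm_num))
  have hq0 : 0 < q := by linarith
  obtain ⟨C₀, hC₀⟩ := lintegral_sum_oscInt_rpow_le hq hκ1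
  obtain ⟨R, hR⟩ := pow_unbounded_of_one_lt (2 * κ ^ 2) (one_lt_two (α := ℝ))
  refine ⟨R * C₀ ^ (1 / q), fun d _ γ I b hI p f hp hf hfin s => ?_⟩
  obtain ⟨c, ρ, hρ, hρ2, hann⟩ := hI.exists_annuli (by linarith)
  set h : ℤ → ℝ → ℂ := fun n t => (dyadicPiece I b n).indicator f t * (weight γ t : ℂ) with hh
  have hhi : ∀ n, Integrable (h n) := fun n => integrable_indicator_mul_weight γ hp hf
    (measurableSet_dyadicPiece hI.ordConnected n) (isBounded_dyadicPiece n)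
  simp only [extOp_eq_oscInt] at hfin ⊢
  change ∀ n, ∫⁻ x, ‖oscInt (curve γ) (h n) x‖ₑ ^ q < ⊤ at hfin
  change eLpNorm (fun x => ∑ n ∈ s, oscInt (curve γ) (h n) x) (ENNReal.ofReal q) volume ≤ _ *
    (∫⁻ x, (∑ n ∈ s, ‖oscInt (curve γ) (h n) x‖ₑ ^ 2) ^ (q / 2)) ^ (1 / q)
  set h' : ℤ → ℝ → ℂ := fun n => if n ∈ s then h n else 0 with hh'
  have hz : ∀ x, oscInt (curve γ) (0 : ℝ → ℂ) x = 0 := fun x => by simp [oscInt]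
  have hh'i : ∀ n, Integrable (h' n) := by
    intro n
    by_cases hn : n ∈ s
    · simpa [hh', hn] using hhi n
    · simp only [hh', hn, if_false]; exact integrable_zero _ _ _
  have hF' : ∀ n x, oscInt (curve γ) (h' n) x = if n ∈ s then oscInt (curve γ) (h n) x else 0 := by
    intro n x
    by_cases hn : n ∈ s
    · simp [hh', hn]
    · simp [hh', hn, hz]
  obtain ⟨a, m, ham⟩ : ∃ (a : ℤ) (m : ℕ), ∀ n ∈ s, ∃ i ∈ Finset.range (R * m), a + (i : ℤ) = n := by
    obtain ⟨a, ha⟩ := s.bddBelow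
    obtain ⟨e, he⟩ := s.bddAbove
    have hR0 : 1 ≤ R := by
      by_contra hlt
      have : R = 0 := by omega
      rw [this, pow_zero] at hR
      nlinarith
    refine ⟨a, (e - a + 1).toNat, fun n hn => ⟨(n - a).toNat, ?_, ?_⟩⟩
    · have h1 := ha hn
      have h2 := he hn
      rw [Finset.mem_range]
      calc (n - a).toNat < (e - a + 1).toNat := by omega
        _ ≤ _ := Nat.le_mul_of_pos_left _ hR0
    · have h1 := ha hn
      omega
  have hinj : ∀ j : ℕ, Function.Injective fun k : ℕ => a + ((j + R * k : ℕ) : ℤ) := by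
    intro j k k' hkk
    have hR0 : R ≠ 0 := by
      rintro rfl
      rw [pow_zero] at hR
      nlinarith
    have h1 : R * k = R * k' := by
      have : (j + R * k : ℕ) = j + R * k' := by exact_mod_cast add_left_cancel hkk
      omega
    exact Nat.eq_of_mul_eq_mul_left (Nat.pos_of_ne_zero hR0) h1
  -- The sum over a single residue class modulo `R`.
  have hclass : ∀ j : ℕ, eLpNorm (fun x => ∑ k ∈ Finset.range m,
      oscInt (curve γ) (h' (a + ((j + R * k : ℕ) : ℤ))) x) (ENNReal.ofReal q) volume ≤
      (C₀ : ℝ≥0∞) ^ (1 / q) *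
        (∫⁻ x, (∑ n ∈ s, ‖oscInt (curve γ) (h n) x‖ₑ ^ 2) ^ (q / 2)) ^ (1 / q) := by
    intro j
    rw [eLpNorm_eq_lintegral_rpow_enorm_toReal (by simpa using hq0) ENNReal.ofReal_ne_top,
      ENNReal.toReal_ofReal hq0.le, ← ENNReal.mul_rpow_of_nonneg _ _ (by positivity)]
    gcongr
    have hmod : ∀ g x, ‖oscInt (fun t => curve γ t - c • firstAxis d) g x‖ₑ =
        ‖oscInt (curve γ) g x‖ₑ := fun g x => by
      simpa using enorm_oscInt_sub_const (curve γ) (c • firstAxis d) {()} (fun _ => g) x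
    have h1 := hC₀ d (fun t => curve γ t - c • firstAxis d) (by fun_prop)
      (fun k => ρ (a + ((j + R * k : ℕ) : ℤ))) (fun k => hρ _) (fun k => ?_)
      (fun k => h' (a + ((j + R * k : ℕ) : ℤ))) (fun k => hh'i _) (fun k t ht => ?_)
      (fun k => ?_) m
    · simp only [enorm_oscInt_sub_const, hmod] at h1
      refine h1.trans ?_
      gcongr with x
      refine (ENNReal.sum_le_tsum _).trans
        ((ENNReal.tsum_comp_le_tsum_of_injective (hinj j)
          fun n => ‖oscInt (curve γ) (h' n) x‖ₑ ^ 2).trans ?_)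
      rw [tsum_eq_sum (s := s) fun n hn => by simp [hF', hn]]
      exact (Finset.sum_congr rfl fun n hn => by rw [hF', if_pos hn]).le
    · have h2 := hρ2 (a + ((j + R * k : ℕ) : ℤ)) R
      have h3 : a + ((j + R * k : ℕ) : ℤ) + R = a + ((j + R * (k + 1) : ℕ) : ℤ) := by
        push_cast; ring
      rw [h3] at h2
      refine le_trans ?_ h2
      gcongr
      exact (hρ _).le
    · have h2 : t ∈ dyadicPiece I b (a + ((j + R * k : ℕ) : ℤ)) := by
        by_contra hne
        refine ht ?_
        by_cases hn : a + ((j + R * k : ℕ) : ℤ) ∈ s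
        · simp only [hh', hn, if_true, hh]
          rw [Set.indicator_of_notMem hne, zero_mul]
        · simp only [hh', hn, if_false, Pi.zero_apply]
      have h3 := hann _ t h2
      have h4 : inner ℝ (firstAxis d) (curve γ t - c • firstAxis d) = (γ 0).eval t - c := by
        simp [firstAxis, curve, inner_sub_right, inner_smul_right, EuclideanSpace.inner_single_left]
      rw [h4]
      exact h3
    · simp only [hmod, hF']
      by_cases hn : a + ((j + R * k : ℕ) : ℤ) ∈ s
      · simpa only [hn, if_true] using hfin _
      · simp only [hn, if_false]
        simp [hq0]
  have hsplit : (fun x => ∑ n ∈ s, oscInt (curve γ) (h n) x) = ∑ j ∈ Finset.range R, fun x =>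
      ∑ k ∈ Finset.range m, oscInt (curve γ) (h' (a + ((j + R * k : ℕ) : ℤ))) x := by
    ext x
    rw [Finset.sum_apply,
      ← sum_range_mul_eq (fun i => oscInt (curve γ) (h' (a + (i : ℤ))) x)]
    have hia : Function.Injective fun i : ℕ => a + (i : ℤ) := fun i i' hi => by simpa using hi
    rw [← Finset.sum_image (f := fun n => oscInt (curve γ) (h' n) x) hia.injOn]
    have hsub : s ⊆ (Finset.range (R * m)).image fun i : ℕ => a + (i : ℤ) := by
      intro n hn
      obtain ⟨i, hi, rfl⟩ := ham n hn
      exact Finset.mem_image_of_mem (fun i : ℕ => a + (i : ℤ)) hi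
    rw [← Finset.sum_subset hsub fun n _ hn => by rw [hF', if_neg hn]]
    exact Finset.sum_congr rfl fun n hn => by rw [hF', if_pos hn]
  rw [hsplit]
  refine (eLpNorm_sum_le (fun j _ => Continuous.aestronglyMeasurable
    (continuous_finsetSum _ fun k _ => continuous_oscInt (by fun_prop) (hh'i _))) ?_).trans ?_
  · rw [ENNReal.one_le_ofReal]; linarith
  · refine (Finset.sum_le_sum fun j _ => hclass j).trans (le_of_eq ?_)
    rw [Finset.sum_const, Finset.card_range, nsmul_eq_mul, ENNReal.coe_mul,
      ENNReal.coe_rpow_of_nonneg _ (by positivity), mul_assoc]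
    simp

/-! ### Identification of the limit and conclusion -/

theorem isExtension_zero {d : ℕ} {γ : Fin d → ℝ[X]} {g : ℝ → ℂ} (hg : g =ᵐ[volume] 0) : IsExtension γ g 0 := by
  refine ⟨locallyIntegrable_zero, fun φ _ _ => ?_⟩
  simp only [Pi.zero_apply, zero_mul, integral_zero]
  symm
  refine integral_eq_zero_of_ae ?_
  filter_upwards [hg] with t ht
  simp [ht]

section
variable {d : ℕ} [NeZero d] {γ : Fin d → ℝ[X]}

theorem derivative_first_ne_zero (h : ∃ t, torsion γ t ≠ 0) : derivative (γ 0) ≠ 0 := by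
  rintro h0
  obtain ⟨t, ht⟩ := h
  refine ht (Matrix.det_eq_zero_of_row_eq_zero 0 fun j => ?_)
  rw [Matrix.of_apply, Function.iterate_succ_apply, h0]
  simp

/-- A curve with torsion not identically zero has a nonconstant first coordinate. -/
theorem natDegree_first_pos (h : ∃ t, torsion γ t ≠ 0) : 0 < (γ 0).natDegree := by
  refine Nat.pos_of_ne_zero fun h0 => derivative_first_ne_zero h ?_
  rw [eq_C_of_natDegree_eq_zero h0, derivative_C]

/-- For `K < 1` the two-sided bounds on `γ₁'` are contradictory away from finitely many points. -/
theorem IsDWInterval.finite_of_lt_one {N : ℕ} {K : ℝ} {I : Set ℝ} {b : ℝ}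
    (hI : IsDWInterval N K γ I b) (hK : K < 1) (h : ∃ t, torsion γ t ≠ 0) : I.Finite := by
  obtain ⟨B, hB, l, -, hl⟩ := hI.deriv_sim
  have hfin : {t : ℝ | (derivative (γ 0)).eval t = 0}.Finite := by
    refine ((derivative (γ 0)).roots.toFinset.finite_toSet).subset fun t ht => ?_
    simpa [derivative_first_ne_zero h] using ht
  refine (hfin.union (Set.finite_singleton b)).subset fun t ht => ?_
  by_cases htb : t = b
  · exact Or.inr htb
  left
  obtain ⟨h1, h2⟩ := hl t ht
  have hX : 0 < B * |t - b| ^ l := by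
    have := abs_pos.2 (sub_ne_zero.2 htb)
    positivity
  rcases le_or_gt K 0 with hK0 | hK0
  · refine abs_eq_zero.1 (le_antisymm (h2.trans ?_) (abs_nonneg _))
    exact mul_nonpos_of_nonpos_of_nonneg hK0 hX.le
  · exfalso
    have h3 : K⁻¹ ≤ K := le_of_mul_le_mul_right (h1.trans h2) hX
    have h4 : 1 < K⁻¹ := (one_lt_inv₀ hK0).2 hK
    linarith

/-- An `L^q` sum of the extensions of the dyadic pieces is the extension of the whole. -/
theorem isExtension_of_hasSum (h : ∃ t, torsion γ t ≠ 0) {p q : ℝ} (hp : 1 < p) (hq : 1 < q)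
    {I : Set ℝ} (hI : I.OrdConnected) {b : ℝ} {f : ℝ → ℂ}
    (hf : MemLp f (ENNReal.ofReal p) (affineArclength γ))
    [Fact (1 ≤ ENNReal.ofReal q)]
    (hF : ∀ n, MemLp (extOp γ ((dyadicPiece I b n).indicator f)) (ENNReal.ofReal q) volume)
    {G : Lp ℂ (ENNReal.ofReal q) (volume : Measure (EuclideanSpace ℝ (Fin d)))}
    (hG : HasSum (fun n => (hF n).toLp (extOp γ ((dyadicPiece I b n).indicator f))) G) :
    IsExtension γ (I.indicator f) G := by
  refine ⟨(Lp.memLp G).locallyIntegrable Fact.out, fun φ hφ hφc => ?_⟩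
  set q' : ℝ := Real.conjExponent q
  have hqq : q.HolderConjugate q' := Real.HolderConjugate.conjExponent hq
  have := hqq.ennrealOfReal
  have : Fact (1 ≤ ENNReal.ofReal q') := ⟨by simpa using hqq.symm.lt.le⟩
  have hφL : MemLp φ (ENNReal.ofReal q') volume := hφ.continuous.memLp_of_hasCompactSupport hφc
  set Λ : Lp ℂ (ENNReal.ofReal q) (volume : Measure (EuclideanSpace ℝ (Fin d))) →L[ℝ] ℂ :=
    ((ContinuousLinearMap.mul ℝ ℂ).lpPairing volume (ENNReal.ofReal q) (ENNReal.ofReal q')).flip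
      (hφL.toLp φ) with hΛ
  have hΛe : ∀ H, Λ H = ∫ x, H x * φ x := by
    intro H
    rw [hΛ, ContinuousLinearMap.flip_apply, ContinuousLinearMap.lpPairing_eq_integral]
    refine integral_congr_ae ?_
    filter_upwards [hφL.coeFn_toLp] with x hx
    simp [hx]
  have h1 := hG.mapL Λ
  rw [hΛe] at h1
  have hms := measurableSet_dyadicPiece (b := b) hI
  set Ψ : ℝ → ℂ := fun t => f t * (weight γ t : ℂ) * curveTransform γ φ t with hΨ
  have hΨi : Integrable Ψ := integrable_mul_curveTransform (natDegree_first_pos h) hφ hφc hp hf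
  have hpiece : ∀ n, Λ ((hF n).toLp (extOp γ ((dyadicPiece I b n).indicator f))) =
      ∫ t in dyadicPiece I b n, Ψ t := by
    intro n
    rw [hΛe, ← integral_indicator (hms n)]
    have h2 := integral_oscInt_mul (γ := γ) hφ.continuous hφc
      (integrable_indicator_mul_weight γ hp hf (hms n) (isBounded_dyadicPiece n))
    rw [← extOp_eq_oscInt] at h2
    refine Eq.trans (integral_congr_ae ?_) (h2.trans (integral_congr_ae ?_))
    · filter_upwards [(hF n).coeFn_toLp] with x hx
      rw [hx]
    · refine Filter.Eventually.of_forall fun t => ?_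
      by_cases ht : t ∈ dyadicPiece I b n <;> simp [ht, hΨ]
  simp only [hpiece] at h1
  have h2 := hasSum_integral_iUnion hms pairwise_disjoint_dyadicPiece hΨi.integrableOn
  rw [h1.unique h2, iUnion_dyadicPiece, ← integral_indicator
    (hI.measurableSet.diff (measurableSet_singleton b))]
  refine integral_congr_ae ?_
  filter_upwards [Measure.ae_ne volume b] with t ht
  by_cases htI : t ∈ I <;> simp [ht, htI, hΨ, curveTransform]

end

end PolyCurve

open PolyCurve

theorem proposition3p2 (d : ℕ) [NeZero d] (N : ℕ) (q : ℝ)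
    (hq : ((d : ℝ) ^ 2 + (d : ℝ) + 2) / 2 < q) (K : ℝ) :
    ∃ C : ℝ≥0, ∀ p p' : ℝ, p.HolderConjugate p' → q = (d : ℝ) * ((d : ℝ) + 1) / 2 * p' →
      ∀ γ : Fin d → ℝ[X], (∀ i, (γ i).natDegree ≤ N) → (∃ t, PolyCurve.torsion γ t ≠ 0) →
      ∀ (I : Set ℝ) (b : ℝ), PolyCurve.IsDWInterval N K γ I b →
      ∀ f : ℝ → ℂ, MemLp f (ENNReal.ofReal p) (PolyCurve.affineArclength γ) →
        PolyCurve.extNorm γ (ENNReal.ofReal q) (I.indicator f) ≤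
          (C : ℝ≥0∞) *
            eLpNorm (PolyCurve.squareFunction γ I b f) (ENNReal.ofReal q) volume := by
  have hd : (1 : ℝ) ≤ d := by exact_mod_cast NeZero.one_le
  have hq2 : 2 < q := by nlinarith
  have hq0 : 0 < q := by linarith
  rcases lt_or_ge K 1 with hK | hK
  · refine ⟨0, fun p p' hpp _ γ _ hγ I b hI f hf => ?_⟩
    have hz : I.indicator f =ᵐ[volume] 0 := by
      filter_upwards [(measure_eq_zero_iff_ae_notMem).1
        ((hI.finite_of_lt_one hK hγ).measure_zero volume)] with t ht
      simp [ht]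
    refine (iInf₂_le (0 : EuclideanSpace ℝ (Fin d) → ℂ) (isExtension_zero hz)).trans ?_
    simp
  obtain ⟨C, hC⟩ := exists_eLpNorm_sum_extOp_le hq2 hK N
  -- A nonzero constant, so that the right side is infinite when the square function is not `L^q`.
  refine ⟨C + 1, fun p p' hpp _ γ _ hγ I b hI f hf => ?_⟩
  have hp : 1 < p := hpp.lt
  set F : ℤ → EuclideanSpace ℝ (Fin d) → ℂ :=
    fun n => extOp γ ((dyadicPiece I b n).indicator f) with hF
  have hSF : eLpNorm (squareFunction γ I b f) (ENNReal.ofReal q) volume =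
      (∫⁻ x, (∑' n, ‖F n x‖ₑ ^ 2) ^ (q / 2)) ^ (1 / q) := by
    rw [eLpNorm_eq_lintegral_rpow_enorm_toReal (by simpa using hq0) ENNReal.ofReal_ne_top,
      ENNReal.toReal_ofReal hq0.le]
    congr 1
    refine lintegral_congr fun x => ?_
    rw [enorm_eq_self, squareFunction, ← ENNReal.rpow_mul]
    congr 1
    ring
  rw [hSF]
  by_cases hS : ∫⁻ x, (∑' n, ‖F n x‖ₑ ^ 2) ^ (q / 2) = ⊤
  · rw [hS, ENNReal.top_rpow_of_pos (by positivity), ENNReal.mul_top (by simp)]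
    exact le_top
  have : Fact (1 ≤ ENNReal.ofReal q) := ⟨by rw [ENNReal.one_le_ofReal]; linarith⟩
  have hFm : ∀ n, Measurable (F n) := fun n => by
    rw [hF]
    simp only [extOp_eq_oscInt]
    exact (continuous_oscInt (by fun_prop) (integrable_indicator_mul_weight γ hp hf
      (measurableSet_dyadicPiece hI.ordConnected n) (isBounded_dyadicPiece n))).measurable
  have hFL := memLp_of_squareFunction hq0 hFm hS
  have hfin : ∀ n, ∫⁻ x, ‖F n x‖ₑ ^ q < ⊤ := fun n => by
    have h1 := (hFL n).2
    rwa [eLpNorm_lt_top_iff_lintegral_rpow_enorm_lt_top (by simpa using hq0) ENNReal.ofReal_ne_top,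
      ENNReal.toReal_ofReal hq0.le] at h1
  obtain ⟨G, hG, hGn⟩ := exists_hasSum_of_squareFunction (by linarith) hFm hFL hS
    (hC d γ I b hI p f hp hf hfin)
  refine (iInf₂_le (G : EuclideanSpace ℝ (Fin d) → ℂ) (isExtension_of_hasSum hγ hp
    (by linarith) hI.ordConnected hf hFL hG)).trans ?_
  rw [← Lp.enorm_def]
  refine hGn.trans ?_
  gcongr
  simp
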